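/- Let $\mathbb{F}_q$ be a finite field, $A=\mathbb{F}_q[\theta]$, $k=\mathbb{F}_q(\theta)$, $v\in A$ monic irreducible, $q_v=q^{\deg v}$, $k_v$ the completion of $k$ at $v$ with normalized valuation $\mathrm{ord}_v$ and valuation ring $A_v$, and $\tau$ the $q$-th power map. Let $r\ge 1$, $\mathfrak{s}=(s_1,\dots,s_r)$ with $s_i\in\mathbb{Z}_{\ge1}$, $\mathrm{wt}(\mathfrak{s})=s_1+\cdots+s_r$, and $\mathbf{u}=(u_1,\dots,u_r)\in A^r$. Put $d_\ell=s_\ell+\cdots+s_r$ and $d=d_1+\cdots+d_r$, and let $G_{\mathfrak{s},\mathbf{u}}=(\mathbb{G}_a^d,\rho)$ be the $t$-module with $\rho_t=\theta I_d+N+E\tau$. Here $N$ is block diagonal with blocks the nilpotent upper Jordan blocks of sizes $d_1,\dots,d_r$, and $E$ is block upper triangular, its block $(\ell,m)$ for $\ell\le m$ having lower left entry $(-1)^{m-\ell}\prod_{e=\ell}^{m-1}u_e$ and all other entries $0$. Its exponential is the unique series $\exp_G=\sum_{i\ge0}Q_i\tau^i$ with $Q_0=I_d$ and $\exp_G\circ(\theta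 I_d+N)=\rho_t\circ\exp_G$, and $\log_G$ is the formal inverse of $\exp_G$. Let $\mathbf{v}_{\mathfrak{s},\mathbf{u}}\in A^d$ be the point whose last coordinate in the $\ell$-th block is $(-1)^{r-\ell}u_\ell\cdots u_r$ and whose other coordinates are $0$. With $\tilde{\mathfrak{s}}=(s_r,\dots,s_1)$, $\tilde{\mathbf{u}}=(u_r,\dots,u_1)$ and $G=G_{\tilde{\mathfrak{s}},\tilde{\mathbf{u}}}$, the $v$-adic Carlitz multiple star polylogarithm (CMSPL) value is $$\mathrm{Li}^\star_{\mathfrak{s}}(\mathbf{u})_v=\frac{(-1)^{r-1}}{a(\theta)}\times\bigl(\text{the }(s_1+\cdots+s_r)\text{-th coordinate of }\log_G(\rho_a(\mathbf{v}_{\tilde{\mathfrak{s}},\tilde{\mathbf{u}}}))\bigr)\in k_v$$ for any nonzero $a\in\mathbb{F}_q[t]$ such that all coordinates of $\rho_a(\mathbf{v}_{\tilde{\mathfrak{s}},\tilde{\mathbf{u}}})$ have $v$-adic absolute value $<1$. Such $a$ exist, the logarithm then converges $v$-adically, and the value does not depend on $a$; so $\mathrm{Li}^\star_{\mathfrak{s}}(\mathbf{u})_v$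 is well defined. Let $S_{0,v}=S^\star_{0,v}=\{1\}$. For $w\ge1$ let $S_{w,v}$ be the set of all $\mathrm{Li}^\star_{\mathfrak{s}}(\mathbf{u})_v$ with $r\ge1$, $\mathrm{wt}(\mathfrak{s})=w$, $\mathbf{u}\in A^r$, and let $S^\star_{w,v}$ be the set of those with $\mathbf{u}\in vA\times A^{r-1}$. Let $\mathcal{L}_{w,v}$ be the $k$-span of $S_{w,v}$ in $k_v$. Then: (1) For every $w\ge0$, $\mathcal{L}_{w,v}$ is spanned over $k$ by $S^\star_{w,v}$, and $\mathcal{L}_v=\sum_{w\ge0}\mathcal{L}_{w,v}$ is a $k$-subalgebra of $k_v$. (2) Let $B_{w,v}=\min_{n\ge0}\{q_v^n-n w\}$. For all $r\ge1$, $\mathfrak{s}$ and $\mathbf{u}\in A^r$, $$\mathrm{ord}_v(\mathrm{Li}^\star_{\mathfrak{s}}(\mathbf{u})_v)\ge B_{\mathrm{wt}(\mathfrak{s}),v},$$ and in particular $\mathrm{Li}^\star_{\mathfrak{s}}(\mathbf{u})_v\in A_v$ if $q_v\ge\mathrm{wt}(\mathfrak{s})$. -/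

import Mathlib

open Polynomial Matrix

noncomputable section

namespace CMSPL

/-! `F = 𝔽_q`, `A = F[X]` with `θ = X`, `k = RatFunc F`.  An index of depth `r + 1` is a function
`s : Fin (r + 1) → ℕ+`; positions are counted from `0`. -/

/-- The weight `s_1 + ⋯ + s_r`. -/
def wt {r : ℕ} (s : Fin (r + 1) → ℕ+) : ℕ := ∑ i, (s i : ℕ)

/-- The block sizes `d_ℓ = s_ℓ + ⋯ + s_r`. -/
def blockSize {r : ℕ} (s : Fin (r + 1) → ℕ+) (l : Fin (r + 1)) : ℕ :=
  ∑ m ∈ Finset.Ici l, (s m : ℕ)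

theorem blockSize_pos {r : ℕ} (s : Fin (r + 1) → ℕ+) (l : Fin (r + 1)) : 0 < blockSize s l :=
  Finset.sum_pos (fun m _ => (s m).pos) ⟨l, Finset.mem_Ici.2 le_rfl⟩

/-- The `d = d_1 + ⋯ + d_r` coordinates, grouped in blocks: `⟨ℓ, j⟩` is the `j`-th coordinate of
the `ℓ`-th block. -/
abbrev Idx {r : ℕ} (s : Fin (r + 1) → ℕ+) : Type := (l : Fin (r + 1)) × Fin (blockSize s l)

/-- The `d_1`-th coordinate, i.e. the last one of the first block. -/
def lastOfFirst {r : ℕ} (s : Fin (r + 1) → ℕ+) : Idx s :=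
  ⟨0, ⟨blockSize s 0 - 1, Nat.sub_lt (blockSize_pos s 0) Nat.one_pos⟩⟩

/-- The block diagonal matrix `N` of nilpotent Jordan blocks. -/
def matN (F : Type*) [Field F] {r : ℕ} (s : Fin (r + 1) → ℕ+) : Matrix (Idx s) (Idx s) F[X] :=
  Matrix.of fun x y => if x.1 = y.1 ∧ (x.2 : ℕ) + 1 = (y.2 : ℕ) then 1 else 0

/-- The block upper triangular matrix `E`: for `ℓ ≤ m`, the lower left corner of the block
`E[ℓ m]` is `(-1)^(m-ℓ) ∏_{ℓ ≤ e < m} u_e`, and all other entries vanish. -/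
def matE {F : Type*} [Field F] {r : ℕ} (s : Fin (r + 1) → ℕ+) (u : Fin (r + 1) → F[X]) :
    Matrix (Idx s) (Idx s) F[X] :=
  Matrix.of fun x y =>
    if x.1 ≤ y.1 ∧ (x.2 : ℕ) + 1 = blockSize s x.1 ∧ (y.2 : ℕ) = 0 then
      (-1) ^ ((y.1 : ℕ) - (x.1 : ℕ)) * ∏ e ∈ Finset.Ico x.1 y.1, u e
    else 0

/-- `∂ρ_t = θ I + N`. -/
def dRho (F : Type*) [Field F] {r : ℕ} (s : Fin (r + 1) → ℕ+) : Matrix (Idx s) (Idx s) F[X] :=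
  (X : F[X]) • (1 : Matrix (Idx s) (Idx s) F[X]) + matN F s

/-- The special point: the last coordinate of block `ℓ` is the signed product
`± u_ℓ ⋯ u_r` (with sign `+` for the last block, then alternating), the others are `0`. -/
def specialPoint {F : Type*} [Field F] {r : ℕ} (s : Fin (r + 1) → ℕ+) (u : Fin (r + 1) → F[X]) :
    Idx s → F[X] := fun x =>
  if (x.2 : ℕ) + 1 = blockSize s x.1 then
    (-1) ^ (r - (x.1 : ℕ)) * ∏ e ∈ Finset.Ici x.1, u e
  else 0

/-- Coordinatewise `q`-th power Frobenius `τ` on `A^d`, as an `F`-linear map. -/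
def tau (F : Type*) [Field F] [Fintype F] (ι : Type*) : (ι → F[X]) →ₗ[F] (ι → F[X]) :=
  LinearMap.pi fun i => (FiniteField.frobeniusAlgHom F F[X]).toLinearMap ∘ₗ LinearMap.proj i

theorem tau_apply (F : Type*) [Field F] [Fintype F] (ι : Type*) (x : ι → F[X]) (i : ι) :
    tau F ι x i = x i ^ Fintype.card F := rfl

/-- `ρ_t = θ I + N + E τ`, acting on the points `A^d` of the `t`-module. -/
def rhoT {F : Type*} [Field F] [Fintype F] {r : ℕ} (s : Fin (r + 1) → ℕ+)
    (u : Fin (r + 1) → F[X]) : Module.End F (Idx s → F[X]) :=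
  (dRho F s).mulVecLin.restrictScalars F + (matE s u).mulVecLin.restrictScalars F ∘ₗ tau F (Idx s)

/-- `ρ_a` for `a ∈ 𝔽_q[t]`, acting on `A^d`. -/
def rho {F : Type*} [Field F] [Fintype F] {r : ℕ} (s : Fin (r + 1) → ℕ+)
    (u : Fin (r + 1) → F[X]) (a : F[X]) : Module.End F (Idx s → F[X]) :=
  aeval (rhoT s u) a

/-- Formal `𝔽_q`-linear power series `∑ P_i τ^i` with `P_i ∈ Mat(k)`. -/
abbrev TauSeries (F : Type*) [Field F] (ι : Type*) : Type _ := ℕ → Matrix ι ι (RatFunc F)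

/-- Composition of `𝔽_q`-linear power series, from `τ^i M = M^(i) τ^i`. -/
def TauSeries.comp {F : Type*} [Field F] [Fintype F] {ι : Type*} [Fintype ι]
    (P Q : TauSeries F ι) : TauSeries F ι := fun n =>
  ∑ ij ∈ Finset.HasAntidiagonal.antidiagonal n,
    P ij.1 * (Q ij.2).map (fun x => x ^ (Fintype.card F) ^ ij.1)

/-- A matrix over `A` as a constant series `M τ^0`. -/
def TauSeries.const {F : Type*} [Field F] {ι : Type*} (M : Matrix ι ι F[X]) : TauSeries F ι
  | 0 => M.map (algebraMap F[X] (RatFunc F))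
  | _ + 1 => 0

/-- `ρ_t = (θ I + N) + E τ` as a series. -/
def rhoSeries {F : Type*} [Field F] {r : ℕ} (s : Fin (r + 1) → ℕ+) (u : Fin (r + 1) → F[X]) :
    TauSeries F (Idx s)
  | 0 => (dRho F s).map (algebraMap F[X] (RatFunc F))
  | 1 => (matE s u).map (algebraMap F[X] (RatFunc F))
  | _ + 2 => 0

/-- `Q` is the exponential of the `t`-module: `Q = 1 + ⋯` and `Q ∘ ∂ρ_t = ρ_t ∘ Q`. As `t`
generates `𝔽_q[t]`, the same identity then holds for all `a ∈ 𝔽_q[t]`. -/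
def IsExp {F : Type*} [Field F] [Fintype F] {r : ℕ} (s : Fin (r + 1) → ℕ+)
    (u : Fin (r + 1) → F[X]) (Q : TauSeries F (Idx s)) : Prop :=
  Q 0 = 1 ∧ Q.comp (TauSeries.const (dRho F s)) = (rhoSeries s u).comp Q

/-- `P` is the logarithm of the `t`-module: the formal inverse of its exponential. -/
def IsLog {F : Type*} [Field F] [Fintype F] {r : ℕ} (s : Fin (r + 1) → ℕ+)
    (u : Fin (r + 1) → F[X]) (P : TauSeries F (Idx s)) : Prop :=
  ∃ Q : TauSeries F (Idx s), IsExp s u Q ∧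
    P.comp Q = TauSeries.const 1 ∧ Q.comp P = TauSeries.const 1

/-- The finite place of `k` given by an irreducible polynomial. -/
def place {F : Type*} [Field F] (v : F[X]) (hv : Irreducible v) :
    IsDedekindDomain.HeightOneSpectrum F[X] where
  asIdeal := Ideal.span {v}
  isPrime := (Ideal.span_singleton_prime hv.ne_zero).2 hv.prime
  ne_bot := by simpa [Ideal.span_singleton_eq_bot] using hv.ne_zero

/-- The completion `k_v`. -/
abbrev Kv {F : Type*} [Field F] (v : F[X]) (hv : Irreducible v) : Type _ :=
  (place v hv).adicCompletion (RatFunc F)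

/-- `q_v = q ^ deg v`. -/
def qv {F : Type*} [Field F] [Fintype F] (v : F[X]) : ℕ := Fintype.card F ^ v.natDegree

/-- `y` is the value of `log(z) = ∑ P_i τ^i(z)` at the point `z ∈ A^d`, the series
converging `v`-adically. -/
def IsLogValue {F : Type*} [Field F] [Fintype F] (v : F[X]) (hv : Irreducible v) {r : ℕ}
    (s : Fin (r + 1) → ℕ+) (u : Fin (r + 1) → F[X]) (z : Idx s → F[X])
    (y : Idx s → Kv v hv) : Prop :=
  ∃ P : TauSeries F (Idx s), IsLog s u P ∧
    HasSum (fun (i : ℕ) (c : Idx s) => algebraMap (RatFunc F) (Kv v hv)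
      ((P i *ᵥ fun b => algebraMap F[X] (RatFunc F) (z b) ^ (Fintype.card F) ^ i) c)) y

/-- `x` is the `v`-adic CMSPL value `Li*_s(u)_v`: for a nonzero `a ∈ 𝔽_q[t]` such that all
coordinates of `ρ_a` of the special point (for the reversed `s` and `u`) have `v`-adic absolute
value `< 1`, it is `(-1)^(depth-1) / a(θ)` times the `d_1`-th coordinate of the logarithm there. -/
def IsLi {F : Type*} [Field F] [Fintype F] (v : F[X]) (hv : Irreducible v) {r : ℕ}
    (s : Fin (r + 1) → ℕ+) (u : Fin (r + 1) → F[X]) (x : Kv v hv) : Prop :=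
  ∃ a : F[X], a ≠ 0 ∧
    (∀ c, (place v hv).valuation (RatFunc F) (algebraMap F[X] (RatFunc F)
      (rho (s ∘ Fin.rev) (u ∘ Fin.rev) a
        (specialPoint (s ∘ Fin.rev) (u ∘ Fin.rev)) c)) < 1) ∧
    ∃ y : Idx (s ∘ Fin.rev) → Kv v hv,
      IsLogValue v hv (s ∘ Fin.rev) (u ∘ Fin.rev)
        (rho (s ∘ Fin.rev) (u ∘ Fin.rev) a (specialPoint (s ∘ Fin.rev) (u ∘ Fin.rev))) y ∧
      x = algebraMap (RatFunc F) (Kv v hv) ((-1) ^ r / aeval (RatFunc.X : RatFunc F) a) *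
        y (lastOfFirst (s ∘ Fin.rev))

/-- `S_{w,v}`: the CMSPL values of weight `w` at points of `A^r`; `S_{0,v} = {1}`. -/
def S {F : Type*} [Field F] [Fintype F] (v : F[X]) (hv : Irreducible v) (w : ℕ) :
    Set (Kv v hv) :=
  if w = 0 then {1} else
    {x | ∃ (r : ℕ) (s : Fin (r + 1) → ℕ+) (u : Fin (r + 1) → F[X]), wt s = w ∧ IsLi v hv s u x}

/-- `S*_{w,v}`: the same with the first argument in `vA`. -/
def Sstar {F : Type*} [Field F] [Fintype F] (v : F[X]) (hv : Irreducible v) (w : ℕ) :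
    Set (Kv v hv) :=
  if w = 0 then {1} else
    {x | ∃ (r : ℕ) (s : Fin (r + 1) → ℕ+) (u : Fin (r + 1) → F[X]),
      wt s = w ∧ v ∣ u 0 ∧ IsLi v hv s u x}

/-- `𝓛_{w,v}`, the `k`-span of `S_{w,v}`. -/
def L {F : Type*} [Field F] [Fintype F] (v : F[X]) (hv : Irreducible v) (w : ℕ) :
    Submodule (RatFunc F) (Kv v hv) :=
  Submodule.span (RatFunc F) (S v hv w)

/-- `B_{w,v} = min_{n ≥ 0} (q_v^n - n w)`. -/
def B {F : Type*} [Field F] [Fintype F] (v : F[X]) (w : ℕ) : ℤ :=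
  ⨅ n : ℕ, ((qv v : ℤ) ^ n - n * w)

theorem one_lt_qv {F : Type*} [Field F] [Fintype F] {v : F[X]} (hv : Irreducible v) :
    1 < qv v :=
  Nat.one_lt_pow hv.natDegree_pos.ne' Fintype.one_lt_card

/-- The minimum defining `B_{w,v}` is attained. -/
theorem B_isLeast {F : Type*} [Field F] [Fintype F] {v : F[X]} (hv : Irreducible v) (w : ℕ) :
    IsLeast (Set.range fun n : ℕ => ((qv v : ℤ) ^ n - n * w)) (B v w) := by
  have hb : BddBelow (Set.range fun n : ℕ => ((qv v : ℤ) ^ n - n * w)) := by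
    refine ⟨-(w * w), ?_⟩
    rintro _ ⟨n, rfl⟩
    have h1 : ((n : ℤ)) < (qv v : ℤ) ^ n := by
      exact_mod_cast Nat.lt_pow_self (one_lt_qv hv)
    rcases le_total n w with h | h
    · have : (n : ℤ) * w ≤ w * w := by gcongr
      simp only
      linarith [Int.natCast_nonneg n]
    · induction n, h using Nat.le_induction with
      | base => simp only; linarith [Int.natCast_nonneg w]
      | succ m hm ih =>
        have hm' : ((m : ℤ)) < (qv v : ℤ) ^ m := by
          exact_mod_cast Nat.lt_pow_self (one_lt_qv hv)
        have := ih hm'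
        have h2 : (2 : ℤ) ≤ qv v := by exact_mod_cast one_lt_qv hv
        have h3 : (w : ℤ) ≤ m := by exact_mod_cast hm
        have h4 : 2 * (qv v : ℤ) ^ m ≤ qv v * (qv v : ℤ) ^ m :=
          mul_le_mul_of_nonneg_right h2 (by positivity)
        simp only at this ⊢
        rw [pow_succ']
        push_cast
        linarith
  exact ⟨Int.csInf_mem (Set.range_nonempty _) hb, fun y hy => csInf_le hb hy⟩

end CMSPL

end

/-! Write `λ_i = θ - θ^(q^i)` and `L_i = λ_1 ⋯ λ_i`. The equation `∂ρ_t ∘ log = log ∘ ρ_t` can be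
solved explicitly for the one row of the logarithm that matters: its entries are `± λ_n^e
L_n^(-d_ℓ)` times a truncated star sum (`LogRec.row_eq`). Since `λ_i y^(q^i) = θ y^(q^i) - (θ
y)^(q^i)`, the powers of `λ_i` can be absorbed into the arguments. So at a point divisible by `v`
the partial sums of this coordinate are `A`-combinations of "small" star sums, those of weight `wt
s` with first argument in `vA` (`logSum_mem`).

Small star sums carry both parts of the theorem. As `λ_i` is separable, and divisible by `v` only if
`deg v ∣ i`, `ord_v L_i` is at most `⌊i / deg v⌋`. The `i`-th increment of a small star sum of
weight `w` then has order at least `q^i - w ⌊i / deg v⌋ ≥ B_{w,v}`, which gives convergence and the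
bound on the limit. For `v ∣ u_1` the value is the limit of its own star sum (`isLi_iff_tendsto`),
so every value is a `k`-combination of such values. The quasi-shuffle product preserves smallness of
the first letter (`starSum_mul_mem_small`), so the spans multiply.

Two facts link this to the definition. The partial sums satisfy `log (ρ_t z) = θ log z` up to a
boundary term tending to `0` (`logSum_rhoT`), so the value is independent of `a`. Modulo `v` the
`t`-module is an iterated extension of Carlitz tensor powers, and `v^(d_ℓ) - 1` kills the `ℓ`-th
one; hence `a` can be taken prime to `v` (`exists_rho_dvd`), and dividing by `a(θ)` costs no
valuation. -/

noncomputable section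

namespace CMSPL

open IsDedekindDomain Filter Topology

/-! ### The polynomials `θ - θ^(q^i)` and their products -/

/-- `θ - θ^(q^i)`. -/
def lam (F : Type*) [Field F] [Fintype F] (i : ℕ) : F[X] := X - X ^ Fintype.card F ^ i

/-- `L_i = ∏_{1 ≤ j ≤ i} (θ - θ^(q^j))`. -/
def lamProd (F : Type*) [Field F] [Fintype F] (i : ℕ) : F[X] := ∏ j ∈ Finset.range i, lam F (j + 1)

section

variable {F : Type*} [Field F] [Fintype F]

theorem lamProd_zero : lamProd F 0 = 1 := rfl

theorem lamProd_succ (i : ℕ) : lamProd F (i + 1) = lamProd F i * lam F (i + 1) :=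
  Finset.prod_range_succ _ _

theorem lam_separable {i : ℕ} (hi : i ≠ 0) : (lam F i).Separable := by
  obtain ⟨p, hp⟩ := CharP.exists F
  have h : (X ^ Fintype.card F ^ i - X : F[X]).Separable :=
    galois_poly_separable p _ (dvd_pow
      ((CharP.cast_eq_zero_iff F p _).1 (FiniteField.cast_card_eq_zero F)) hi)
  have h2 : lam F i = C (-1) * (X ^ Fintype.card F ^ i - X) := by
    simp [lam]
  rw [h2]
  rw [C_neg, C_1]
  exact h.unit_mul isUnit_one.neg

theorem lam_ne_zero {i : ℕ} (hi : i ≠ 0) : lam F i ≠ 0 := (lam_separable hi).ne_zero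

/-- The roots of `θ^(q^i) - θ` form the field with `q^i` elements, whose subfields have degree
dividing `i`. -/
theorem natDegree_dvd_of_dvd_lam {v : F[X]} (hv : Irreducible v) {i : ℕ} (h : v ∣ lam F i) :
    v.natDegree ∣ i := by
  refine hv.natDegree_dvd_of_dvd_X_pow_card_pow_sub_X ?_
  rw [Nat.card_eq_fintype_card, ← neg_sub]
  exact (dvd_neg).2 h

theorem not_sq_dvd_lam {v : F[X]} (hv : Irreducible v) {i : ℕ} (hi : i ≠ 0) :
    ¬ v ^ 2 ∣ lam F i := fun h =>
  hv.not_isUnit ((lam_separable hi).squarefree v (by rwa [← sq]))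

end

/-! ### The `v`-adic valuation -/

section

variable {F : Type*} [Field F] (v : F[X]) (hv : Irreducible v)

/-- The embedding of `A` into `k`. -/
abbrev toK (F : Type*) [Field F] : F[X] →+* RatFunc F := algebraMap F[X] (RatFunc F)

/-- The `v`-adic valuation of `k`. -/
abbrev val : Valuation (RatFunc F) (WithZero (Multiplicative ℤ)) :=
  (place v hv).valuation (RatFunc F)

theorem val_toK_le_one (a : F[X]) : val v hv (toK F a) ≤ 1 := (place v hv).valuation_le_one a

theorem val_toK_le_exp_iff (a : F[X]) (n : ℕ) :
    val v hv (toK F a) ≤ WithZero.exp (-(n : ℤ)) ↔ v ^ n ∣ a := by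
  rw [HeightOneSpectrum.valuation_of_algebraMap, HeightOneSpectrum.intValuation_le_pow_iff_mem]
  change a ∈ (Ideal.span {v}) ^ n ↔ _
  rw [Ideal.span_singleton_pow, Ideal.mem_span_singleton]

theorem val_toK_lt_one_iff (a : F[X]) : val v hv (toK F a) < 1 ↔ v ∣ a := by
  rw [HeightOneSpectrum.valuation_lt_one_iff_mem]
  change a ∈ (Ideal.span {v}) ↔ _
  rw [Ideal.mem_span_singleton]

theorem val_toK_inv_le {a : F[X]} (ha : a ≠ 0) {n : ℕ} (h : ¬ v ^ (n + 1) ∣ a) :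
    val v hv (toK F a)⁻¹ ≤ WithZero.exp (n : ℤ) := by
  rw [← val_toK_le_exp_iff v hv, not_le] at h
  have h0 : val v hv (toK F a) ≠ 0 := by simpa using ha
  rw [map_inv₀, ← WithZero.exp_log h0, ← WithZero.exp_neg, WithZero.exp_le_exp]
  rw [← WithZero.exp_log h0, WithZero.exp_lt_exp] at h
  push_cast at h
  omega

/-- Separability allows at most one factor `v`, and that one only when `deg v ∣ i`. -/
theorem val_lam_inv_le [Fintype F] {i : ℕ} (hi : i ≠ 0) :
    val v hv (toK F (lam F i))⁻¹ ≤
      WithZero.exp (((if v.natDegree ∣ i then 1 else 0 : ℕ) : ℤ)) := by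
  refine val_toK_inv_le v hv (lam_ne_zero hi) ?_
  split_ifs with h
  · exact not_sq_dvd_lam hv hi
  · rw [zero_add, pow_one]
    exact fun h' => h (natDegree_dvd_of_dvd_lam hv h')

theorem val_lamProd_inv_le [Fintype F] (i : ℕ) :
    val v hv (toK F (lamProd F i))⁻¹ ≤ WithZero.exp ((i / v.natDegree : ℕ) : ℤ) := by
  induction i with
  | zero => simp [lamProd_zero]
  | succ i ih =>
    -- The quotient `(i + 1) / deg v` increases by one exactly when `deg v ∣ i + 1`, matching the
    -- bound for the new factor.
    rw [lamProd_succ, map_mul, mul_inv, map_mul, Nat.succ_div, Nat.cast_add, WithZero.exp_add]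
    exact mul_le_mul' ih (val_lam_inv_le v hv i.succ_ne_zero)

/-! ### Convergence in `k_v` -/

/-- The embedding of `k` into `k_v`. -/
abbrev toKv : RatFunc F →+* Kv v hv := algebraMap (RatFunc F) (Kv v hv)

theorem valued_toKv (x : RatFunc F) : Valued.v (toKv v hv x) = val v hv x :=
  (place v hv).valuedAdicCompletion_eq_valuation' x

instance : NonarchimedeanRing (Kv v hv) where
  is_nonarchimedean := by
    intro U hU
    obtain ⟨γ, hγ⟩ := Valued.mem_nhds_zero.1 hU
    exact ⟨⟨Valuation.ltAddSubgroup Valued.v.restrict γ, Valued.isOpen_ball _ _⟩, hγ⟩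

variable {v hv}

theorem tendsto_zero_of_valued_le {a : ℕ → Kv v hv} {φ : ℕ → ℤ} (hφ : Tendsto φ atTop atTop)
    (h : ∀ n, Valued.v (a n) ≤ WithZero.exp (-φ n)) : Tendsto a atTop (𝓝 0) := by
  rw [((Valued.hasBasis_nhds_zero (Kv v hv) _).tendsto_right_iff)]
  intro γ _
  have hγ : MonoidWithZeroHom.ValueGroup₀.embedding γ.1 ≠ 0 := (_root_.map_ne_zero _).2 γ.ne_zero
  filter_upwards [hφ.eventually_gt_atTop
    (-(WithZero.log (MonoidWithZeroHom.ValueGroup₀.embedding γ.1)))] with n hn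
  rw [Valuation.restrict_lt_iff_lt_embedding]
  refine (h n).trans_lt ?_
  rw [← WithZero.exp_log hγ, WithZero.exp_lt_exp]
  linarith

theorem valued_le_of_tendsto {a : ℕ → Kv v hv} {x : Kv v hv} (h : Tendsto a atTop (𝓝 x))
    {c : WithZero (Multiplicative ℤ)} (hc : ∀ n, Valued.v (a n) ≤ c) : Valued.v x ≤ c := by
  by_contra! hlt
  -- The valuation is locally constant away from `0`, so it is eventually equal to that of the
  -- limit.
  obtain ⟨n, hn⟩ := (h.eventually (Valued.locally_const (ne_of_gt (zero_le.trans_lt hlt)))).exists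
  exact absurd (hc n) (by rw [hn]; exact not_le.2 hlt)

theorem summable_of_valued_le {a : ℕ → Kv v hv} {φ : ℕ → ℤ} (hφ : Tendsto φ atTop atTop)
    (h : ∀ n, Valued.v (a n) ≤ WithZero.exp (-φ n)) : Summable a := by
  refine NonarchimedeanAddGroup.summable_of_tendsto_cofinite_zero ?_
  rw [Nat.cofinite_eq_atTop]
  exact tendsto_zero_of_valued_le hφ h

end

/-! ### Truncated star sums -/

section

variable {F : Type*} [Field F] [Fintype F]

/-- `u^(q^i) / L_i^s` for the letter `x = (s, u)`. -/
def term (x : ℕ+ × F[X]) (i : ℕ) : RatFunc F :=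
  toK F x.2 ^ Fintype.card F ^ i * (toK F (lamProd F i))⁻¹ ^ (x.1 : ℕ)

/-- The operator `g ↦ (n ↦ ∑_{i < n} u^(q^i) / L_i^s * g (i + 1))` for the letter `x = (s, u)`. -/
def sumOp (x : ℕ+ × F[X]) : (ℕ → RatFunc F) →ₗ[F[X]] (ℕ → RatFunc F) where
  toFun g n := ∑ i ∈ Finset.range n, term x i * g (i + 1)
  map_add' g h := by
    ext n
    simp [mul_add, Finset.sum_add_distrib]
  map_smul' c g := by
    ext n
    simp [Finset.smul_sum]

theorem sumOp_zero (x : ℕ+ × F[X]) (g : ℕ → RatFunc F) : sumOp x g 0 = 0 := by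
  simp [sumOp]

theorem sumOp_succ (x : ℕ+ × F[X]) (g : ℕ → RatFunc F) (n : ℕ) :
    sumOp x g (n + 1) = sumOp x g n + term x n * g (n + 1) :=
  Finset.sum_range_succ _ _

/-- The star sum `∑_{n > i_1 ≥ i_2 ≥ ⋯} ∏ u_j^(q^(i_j)) / L_(i_j)^(s_j)`, as a function of `n`. -/
def starSum : List (ℕ+ × F[X]) → ℕ → RatFunc F
  | [] => 1
  | x :: w => sumOp x (starSum w)

omit [Fintype F] in
/-- The weight of a list of letters `(s, u)`. -/
def weight : List (ℕ+ × F[X]) → ℕ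
  | [] => 0
  | x :: w => x.1 + weight w

/-- The letter `(s + s', u u')`. -/
def merge (x y : ℕ+ × F[X]) : ℕ+ × F[X] := (x.1 + y.1, x.2 * y.2)

theorem term_merge (x y : ℕ+ × F[X]) (i : ℕ) : term (merge x y) i = term x i * term y i := by
  simp only [term, merge, PNat.add_coe, map_mul, mul_pow, pow_add]
  ring

/-- The quasi-shuffle recursion. -/
theorem starSum_mul (x y : ℕ+ × F[X]) (a b : List (ℕ+ × F[X])) :
    starSum (x :: a) * starSum (y :: b) =
      sumOp x (starSum a * starSum (y :: b)) + sumOp y (starSum (x :: a) * starSum b) -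
        sumOp (merge x y) (starSum a * starSum b) := by
  ext n
  simp only [Pi.mul_apply, Pi.sub_apply, Pi.add_apply]
  -- Discrete product rule: `Δ(fg)(n) = Δf(n) g(n+1) + f(n+1) Δg(n) - Δf(n) Δg(n)`. The last term
  -- produces the merged letter.
  induction n with
  | zero => simp [starSum, sumOp_zero]
  | succ n ih =>
    simp only [sumOp_succ, term_merge, Pi.mul_apply]
    have hx : starSum (x :: a) (n + 1) = starSum (x :: a) n + term x n * starSum a (n + 1) :=
      sumOp_succ _ _ _
    have hy : starSum (y :: b) (n + 1) = starSum (y :: b) n + term y n * starSum b (n + 1) :=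
      sumOp_succ _ _ _
    rw [hx, hy]
    linear_combination ih

/-- The span of the star sums of weight `w`. -/
def starSpan (F : Type*) [Field F] [Fintype F] (w : ℕ) : Submodule F[X] (ℕ → RatFunc F) :=
  Submodule.span F[X] {g | ∃ c : List (ℕ+ × F[X]), weight c = w ∧ starSum c = g}

/-- The span of the star sums of weight `w` whose first argument is divisible by `v`. -/
def smallStarSpan (v : F[X]) (w : ℕ) : Submodule F[X] (ℕ → RatFunc F) :=
  Submodule.span F[X] {g | ∃ (x : ℕ+ × F[X]) (c : List (ℕ+ × F[X])),
    v ∣ x.2 ∧ weight (x :: c) = w ∧ starSum (x :: c) = g}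

theorem starSum_mem {w : ℕ} (c : List (ℕ+ × F[X])) (h : weight c = w) :
    starSum c ∈ starSpan F w :=
  Submodule.subset_span ⟨c, h, rfl⟩

theorem starSum_mem_small {v : F[X]} {w : ℕ} {x : ℕ+ × F[X]} (hx : v ∣ x.2)
    (c : List (ℕ+ × F[X])) (h : weight (x :: c) = w) :
    starSum (x :: c) ∈ smallStarSpan v w :=
  Submodule.subset_span ⟨x, c, hx, h, rfl⟩

theorem sumOp_mem (x : ℕ+ × F[X]) {w w' : ℕ} {g : ℕ → RatFunc F} (hg : g ∈ starSpan F w)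
    (hw : x.1 + w = w') : sumOp x g ∈ starSpan F w' := by
  refine (Submodule.map_span_le (sumOp x) _ (starSpan F w')).2 ?_ (Submodule.mem_map_of_mem hg)
  rintro _ ⟨c, hc, rfl⟩
  exact starSum_mem (x :: c) (by rw [← hw, ← hc, weight])

theorem sumOp_mem_small {v : F[X]} {x : ℕ+ × F[X]} (hx : v ∣ x.2) {w w' : ℕ} {g : ℕ → RatFunc F}
    (hg : g ∈ starSpan F w) (hw : x.1 + w = w') : sumOp x g ∈ smallStarSpan v w' := by
  refine (Submodule.map_span_le (sumOp x) _ (smallStarSpan v w')).2 ?_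
    (Submodule.mem_map_of_mem hg)
  rintro _ ⟨c, hc, rfl⟩
  exact starSum_mem_small hx c (by rw [← hw, ← hc, weight])

theorem starSum_mul_mem (a b : List (ℕ+ × F[X])) :
    starSum a * starSum b ∈ starSpan F (weight a + weight b) := by
  match a, b with
  | [], b => simpa [starSum, weight] using starSum_mem b rfl
  | x :: a, [] => simpa [starSum, weight] using starSum_mem (x :: a) rfl
  | x :: a, y :: b =>
    rw [starSum_mul]
    refine sub_mem (add_mem ?_ ?_) ?_
    · exact sumOp_mem x (starSum_mul_mem a (y :: b)) (by simp only [weight]; ring)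
    · exact sumOp_mem y (starSum_mul_mem (x :: a) b) (by simp only [weight]; ring)
    · exact sumOp_mem _ (starSum_mul_mem a b) (by simp only [weight, merge, PNat.add_coe]; ring)
termination_by a.length + b.length

/-- The outermost letters in the quasi-shuffle recursion are `x`, `y` and their merge, all with
argument divisible by `v`; the tails need no divisibility. -/
theorem starSum_mul_mem_small {v : F[X]} {x y : ℕ+ × F[X]} (hx : v ∣ x.2) (hy : v ∣ y.2)
    (a b : List (ℕ+ × F[X])) :
    starSum (x :: a) * starSum (y :: b) ∈
      smallStarSpan v (weight (x :: a) + weight (y :: b)) := by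
  rw [starSum_mul]
  refine sub_mem (add_mem ?_ ?_) ?_
  · exact sumOp_mem_small hx (starSum_mul_mem a (y :: b)) (by simp only [weight]; ring)
  · exact sumOp_mem_small hy (starSum_mul_mem (x :: a) b) (by simp only [weight]; ring)
  · exact sumOp_mem_small (hx.mul_right _) (starSum_mul_mem a b)
      (by simp only [weight, merge, PNat.add_coe]; ring)

/-! ### Growth of star sums -/

variable (v : F[X]) (hv : Irreducible v)

omit [Fintype F] in
theorem val_toK_smul_le (a : F[X]) (x : RatFunc F) : val v hv (a • x) ≤ val v hv x := by
  rw [Algebra.smul_def, map_mul]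
  exact mul_le_of_le_one_left' (val_toK_le_one v hv a)

theorem val_term_le (x : ℕ+ × F[X]) (i : ℕ) :
    val v hv (term x i) ≤ WithZero.exp ((x.1 : ℤ) * (i / v.natDegree : ℕ)) := by
  rw [term, map_mul, map_pow, map_pow]
  refine (mul_le_of_le_one_left' (pow_le_one' (val_toK_le_one v hv _) _)).trans ?_
  refine (pow_le_pow_left' (val_lamProd_inv_le v hv i) _).trans (le_of_eq ?_)
  rw [← WithZero.exp_nsmul]
  simp

theorem val_term_le_of_dvd {x : ℕ+ × F[X]} (hx : v ∣ x.2) (i : ℕ) :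
    val v hv (term x i) ≤
      WithZero.exp (-((Fintype.card F : ℤ) ^ i - (x.1 : ℤ) * (i / v.natDegree : ℕ))) := by
  rw [term, map_mul, map_pow _ _ (x.1 : ℕ), ← map_pow (toK F)]
  have h1 : val v hv (toK F (x.2 ^ Fintype.card F ^ i)) ≤
      WithZero.exp (-((Fintype.card F ^ i : ℕ) : ℤ)) :=
    (val_toK_le_exp_iff v hv _ _).2 (pow_dvd_pow_of_dvd hx _)
  refine (mul_le_mul' h1 (pow_le_pow_left' (val_lamProd_inv_le v hv i) _)).trans (le_of_eq ?_)
  rw [← WithZero.exp_nsmul, ← WithZero.exp_add]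
  congr 1
  simp only [nsmul_eq_mul]
  push_cast
  ring

/-- All summation indices are at most `n`, so each letter costs at most `s_j ⌊n / deg v⌋`. -/
theorem val_starSum_le (c : List (ℕ+ × F[X])) (n : ℕ) :
    val v hv (starSum c (n + 1)) ≤ WithZero.exp ((weight c : ℤ) * (n / v.natDegree : ℕ)) := by
  induction c generalizing n with
  | nil => simp [starSum, weight]
  | cons x c ih =>
    change val v hv (∑ i ∈ Finset.range (n + 1), term x i * starSum c (i + 1)) ≤ _
    refine Valuation.map_sum_le (val v hv) fun i hi => ?_
    have hin : i / v.natDegree ≤ n / v.natDegree :=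
      Nat.div_le_div_right (Nat.lt_succ_iff.1 (Finset.mem_range.1 hi))
    rw [map_mul]
    refine (mul_le_mul' (val_term_le v hv x i) (ih i)).trans ?_
    rw [← WithZero.exp_add, WithZero.exp_le_exp, ← add_mul, weight]
    push_cast
    gcongr
    exact_mod_cast hin

/-- A lower bound for the order of the `i`-th increment of a star sum of weight `w`. -/
def growth (w i : ℕ) : ℤ := (Fintype.card F : ℤ) ^ i - w * (i / v.natDegree : ℕ)

/-- The increment puts the first index equal to `i`. The gain `q^i` comes from the first argument
alone; the denominators of all letters together lose at most `w ⌊i / deg v⌋`. -/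
theorem val_sub_le_of_mem_small {w : ℕ} {g : ℕ → RatFunc F} (hg : g ∈ smallStarSpan v w) (i : ℕ) :
    val v hv (g (i + 1) - g i) ≤ WithZero.exp (-growth v w i) := by
  induction hg using Submodule.span_induction with
  | mem g hg =>
    obtain ⟨x, c, hx, rfl, rfl⟩ := hg
    rw [starSum, sumOp_succ, add_sub_cancel_left, map_mul]
    refine (mul_le_mul' (val_term_le_of_dvd v hv hx i) (val_starSum_le v hv c i)).trans
      (le_of_eq ?_)
    rw [← WithZero.exp_add, growth, weight]
    congr 1
    push_cast
    ring
  | zero => simp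
  | add g h _ _ h1 h2 =>
    rw [Pi.add_apply, Pi.add_apply, add_sub_add_comm]
    exact Valuation.map_add_le _ h1 h2
  | smul a g _ h =>
    rw [Pi.smul_apply, Pi.smul_apply, ← smul_sub]
    exact (val_toK_smul_le v hv _ _).trans h

theorem apply_zero_of_mem_small {w : ℕ} {g : ℕ → RatFunc F} (hg : g ∈ smallStarSpan v w) :
    g 0 = 0 := by
  induction hg using Submodule.span_induction with
  | mem g hg =>
    obtain ⟨x, c, hx, rfl, rfl⟩ := hg
    exact sumOp_zero _ _
  | zero => rfl
  | add g h _ _ h1 h2 => rw [Pi.add_apply, h1, h2, add_zero]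
  | smul a g _ h => rw [Pi.smul_apply, h, smul_zero]

variable {v} in
include hv in
theorem B_le_growth (w i : ℕ) : B v w ≤ growth v w i := by
  -- Compare with `n = ⌊i / deg v⌋` in the minimum: `q_v^n = q^(n deg v) ≤ q^i`.
  refine ((B_isLeast hv w).2 ⟨i / v.natDegree, rfl⟩).trans ?_
  change (qv v : ℤ) ^ (i / v.natDegree) - ((i / v.natDegree : ℕ) : ℤ) * w ≤ _
  rw [growth, mul_comm (w : ℤ)]
  refine sub_le_sub_right ?_ _
  rw [qv]
  push_cast
  rw [← pow_mul]
  exact pow_le_pow_right₀ (by exact_mod_cast Fintype.card_pos) (Nat.mul_div_le _ _)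

theorem tendsto_card_pow_sub (F : Type*) [Field F] [Fintype F] (C : ℕ) :
    Tendsto (fun i : ℕ => (Fintype.card F : ℤ) ^ i - C * i) atTop atTop := by
  refine tendsto_atTop_mono' atTop ?_ tendsto_natCast_atTop_atTop
  -- With `m = ⌊i / 2⌋`, this threshold gives `q^i ≥ (m + 1)^2 ≥ 2 (C + 1) (m + 1) ≥ (C + 1) i`,
  -- hence `q^i - C i ≥ i`.
  filter_upwards [eventually_ge_atTop (4 * (C + 1))] with i hi
  obtain ⟨m, hm⟩ : ∃ m, i / 2 = m := ⟨_, rfl⟩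
  have h1 : (2 : ℤ) ^ i ≤ (Fintype.card F : ℤ) ^ i :=
    pow_le_pow_left₀ (by norm_num) (by exact_mod_cast Fintype.one_lt_card) _
  have h2 : ((m : ℤ) + 1) ^ 2 ≤ 2 ^ i := by
    have h3 : (m : ℤ) + 1 ≤ 2 ^ m := by exact_mod_cast Nat.lt_two_pow_self
    calc ((m : ℤ) + 1) ^ 2 ≤ (2 ^ m) ^ 2 := by gcongr
      _ = 2 ^ (m * 2) := by rw [pow_mul]
      _ ≤ 2 ^ i := pow_le_pow_right₀ (by norm_num) (by omega)
  have h4 : (i : ℤ) ≤ 2 * (m + 1) := by omega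
  have h5 : 2 * ((C : ℤ) + 1) ≤ m + 1 := by omega
  nlinarith

theorem tendsto_growth (w : ℕ) : Tendsto (growth v w) atTop atTop := by
  refine tendsto_atTop_mono (fun i => ?_) (tendsto_card_pow_sub F w)
  rw [growth]
  gcongr
  exact Nat.div_le_self _ _

variable {v} in
/-- Elements of the small star span converge `v`-adically. -/
theorem exists_tendsto_of_mem_small {w : ℕ} {g : ℕ → RatFunc F} (hg : g ∈ smallStarSpan v w) :
    ∃ x, Tendsto (fun n => toKv v hv (g n)) atTop (𝓝 x) ∧
      Valued.v x ≤ WithZero.exp (-B v w) := by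
  have h1 (i : ℕ) : Valued.v (toKv v hv (g (i + 1) - g i)) ≤ WithZero.exp (-growth v w i) := by
    rw [valued_toKv]
    exact val_sub_le_of_mem_small v hv hg i
  obtain ⟨x, hx⟩ := summable_of_valued_le (tendsto_growth v w) h1
  have h2 (n : ℕ) : ∑ i ∈ Finset.range n, toKv v hv (g (i + 1) - g i) = toKv v hv (g n) := by
    rw [← map_sum, Finset.sum_range_sub, apply_zero_of_mem_small v hg, sub_zero]
  have h3 := hx.tendsto_sum_nat
  simp only [h2] at h3
  refine ⟨x, h3, valued_le_of_tendsto h3 fun n => ?_⟩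
  rw [← h2]
  refine Valuation.map_sum_le _ fun i _ => (h1 i).trans ?_
  rw [WithZero.exp_le_exp]
  exact neg_le_neg (B_le_growth hv w i)

end

/-! ### Composition of `τ`-series -/

section

variable {F : Type*} [Field F] [Fintype F]

/-- The `i`-th power `x ↦ x^(q^i)` of the Frobenius of `k`. -/
def frob (F : Type*) [Field F] [Fintype F] (i : ℕ) : RatFunc F →+* RatFunc F :=
  ((FiniteField.frobeniusAlgHom F (RatFunc F)) ^ i : RatFunc F →ₐ[F] RatFunc F)

theorem frob_apply (i : ℕ) (x : RatFunc F) : frob F i x = x ^ Fintype.card F ^ i := by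
  change ((FiniteField.frobeniusAlgHom F (RatFunc F)) ^ i) x = _
  rw [AlgHom.coe_pow, FiniteField.coe_frobeniusAlgHom, pow_iterate]

theorem frob_zero : frob F 0 = RingHom.id _ := by
  ext x
  simp [frob_apply]

theorem frob_frob (i j : ℕ) (x : RatFunc F) : frob F i (frob F j x) = frob F (i + j) x := by
  simp only [frob_apply, ← pow_mul, pow_add]
  rw [mul_comm]

theorem coe_frob (i : ℕ) : (fun x : RatFunc F => x ^ Fintype.card F ^ i) = frob F i :=
  funext fun x => (frob_apply i x).symm

variable {ι : Type*} [Fintype ι]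

namespace TauSeries

theorem comp_apply (P Q : TauSeries F ι) (n : ℕ) :
    P.comp Q n = ∑ ij ∈ Finset.HasAntidiagonal.antidiagonal n,
      P ij.1 * (Q ij.2).map (frob F ij.1) := by
  simp only [comp, coe_frob]

theorem comp_assoc (P Q R : TauSeries F ι) : (P.comp Q).comp R = P.comp (Q.comp R) := by
  classical
  ext1 n
  simp only [comp_apply, Finset.sum_mul]
  have h (i : ℕ × ℕ) : (∑ x ∈ Finset.HasAntidiagonal.antidiagonal i.2,
      Q x.1 * (R x.2).map (frob F x.1)).map (frob F i.1) =
      ∑ x ∈ Finset.HasAntidiagonal.antidiagonal i.2,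
        (Q x.1).map (frob F i.1) * (R x.2).map (frob F (i.1 + x.1)) := by
    change (frob F i.1).mapMatrix _ = _
    rw [map_sum]
    refine Finset.sum_congr rfl fun x _ => ?_
    rw [map_mul]
    congr 1
    ext a b
    exact frob_frob _ _ _
  simp only [h, Finset.mul_sum]
  rw [Finset.sum_sigma', Finset.sum_sigma']
  -- Both sides are sums over the triples of exponents with total `n`, bracketed differently.
  refine Finset.sum_nbij' (fun x => ⟨(x.2.1, x.2.2 + x.1.2), (x.2.2, x.1.2)⟩)
    (fun x => ⟨(x.1.1 + x.2.1, x.2.2), (x.1.1, x.2.1)⟩) ?_ ?_ ?_ ?_ ?_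
  · rintro ⟨⟨a, b⟩, ⟨c, d⟩⟩ hx
    simp only [Finset.mem_sigma, Finset.HasAntidiagonal.mem_antidiagonal] at hx ⊢
    obtain ⟨rfl, rfl⟩ := hx
    exact ⟨(add_assoc _ _ _).symm, trivial⟩
  · rintro ⟨⟨a, b⟩, ⟨c, d⟩⟩ hx
    simp only [Finset.mem_sigma, Finset.HasAntidiagonal.mem_antidiagonal] at hx ⊢
    obtain ⟨rfl, rfl⟩ := hx
    exact ⟨add_assoc _ _ _, trivial⟩
  · rintro ⟨⟨a, b⟩, ⟨c, d⟩⟩ hx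
    simp only [Finset.mem_sigma, Finset.HasAntidiagonal.mem_antidiagonal] at hx
    obtain ⟨rfl, rfl⟩ := hx
    rfl
  · rintro ⟨⟨a, b⟩, ⟨c, d⟩⟩ hx
    simp only [Finset.mem_sigma, Finset.HasAntidiagonal.mem_antidiagonal] at hx
    obtain ⟨rfl, rfl⟩ := hx
    rfl
  · rintro ⟨⟨a, b⟩, ⟨c, d⟩⟩ hx
    simp only [Finset.mem_sigma, Finset.HasAntidiagonal.mem_antidiagonal] at hx
    obtain ⟨rfl, rfl⟩ := hx
    simp only [mul_assoc]

theorem comp_const (P : TauSeries F ι) (M : Matrix ι ι F[X]) (n : ℕ) :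
    P.comp (const M) n = P n * (M.map (toK F)).map (frob F n) := by
  rw [comp_apply, Finset.sum_eq_single (n, 0)]
  · rfl
  · rintro ⟨a, b⟩ hx h
    obtain _ | b := b
    · simp only [Finset.HasAntidiagonal.mem_antidiagonal, add_zero] at hx
      exact absurd (by rw [hx]) h
    · change P a * (0 : Matrix ι ι (RatFunc F)).map (frob F a) = 0
      rw [Matrix.map_zero _ (map_zero _), mul_zero]
  · simp

theorem const_comp (P : TauSeries F ι) (M : Matrix ι ι F[X]) (n : ℕ) :
    (const M).comp P n = M.map (toK F) * P n := by
  rw [comp_apply, Finset.sum_eq_single (0, n)]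
  · simp [frob_zero, const]
  · rintro ⟨a, b⟩ hx h
    obtain _ | a := a
    · simp only [Finset.HasAntidiagonal.mem_antidiagonal, zero_add] at hx
      exact absurd (by rw [hx]) h
    · exact zero_mul _
  · simp

variable [DecidableEq ι]

theorem comp_one (P : TauSeries F ι) : P.comp (const 1) = P := by
  ext1 n
  rw [comp_const]
  simp

theorem one_comp (P : TauSeries F ι) : (const 1 : TauSeries F ι).comp P = P := by
  ext1 n
  rw [const_comp]
  simp

end TauSeries

end

/-! ### Sylvester operators -/

/-- Left and right multiplication by `N` are commuting nilpotents, so `R ↦ [N, R]` is nilpotent, and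
a nonzero scalar plus a nilpotent is invertible. This is the operator to invert in each step of the
recursions for the exponential and the logarithm. -/
theorem bijective_smul_add_commutator {K A : Type*} [Field K] [Ring A] [Algebra K A] {N : A}
    (hN : IsNilpotent N) {c : K} (hc : c ≠ 0) :
    Function.Bijective fun R : A => c • R + (N * R - R * N) := by
  have hl : IsNilpotent (LinearMap.mulLeft K N) := by rwa [LinearMap.isNilpotent_mulLeft_iff]
  have hr : IsNilpotent (LinearMap.mulRight K N) := by rwa [LinearMap.isNilpotent_mulRight_iff]
  have h1 : IsUnit (algebraMap K (Module.End K A) c +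
      (LinearMap.mulLeft K N - LinearMap.mulRight K N)) :=
    ((LinearMap.commute_mulLeft_right N N).isNilpotent_sub hl hr).isUnit_add_left_of_commute
      ((IsUnit.mk0 c hc).map _) (Algebra.commutes _ _).symm
  exact (Module.End.isUnit_iff _).1 h1

/-! ### Existence and uniqueness of the logarithm -/

section

variable {F : Type*} [Field F] {r : ℕ} (s : Fin (r + 1) → ℕ+) (u : Fin (r + 1) → F[X])

/-- `N` over `k`. -/
abbrev matNK (F : Type*) [Field F] {r : ℕ} (s : Fin (r + 1) → ℕ+) :
    Matrix (Idx s) (Idx s) (RatFunc F) := (matN F s).map (toK F)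

/-- `E` over `k`. -/
abbrev matEK : Matrix (Idx s) (Idx s) (RatFunc F) := (matE s u).map (toK F)

theorem matNK_apply (x y : Idx s) :
    matNK F s x y = if x.1 = y.1 ∧ (x.2 : ℕ) + 1 = (y.2 : ℕ) then 1 else 0 := by
  simp [matNK, matN, apply_ite (toK F)]

theorem isNilpotent_matNK : IsNilpotent (matNK F s) := by
  -- `N^m` raises the position within a block by exactly `m`, which is impossible once `m` reaches
  -- the block size.
  have h (m : ℕ) (x y : Idx s) : (matNK F s ^ m) x y ≠ 0 → (y.2 : ℕ) = x.2 + m := by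
    induction m generalizing y with
    | zero =>
      intro h
      rw [pow_zero, Matrix.one_apply] at h
      obtain rfl : x = y := by
        by_contra hxy
        simp [hxy] at h
      rfl
    | succ m ih =>
      intro h
      rw [pow_succ, Matrix.mul_apply] at h
      obtain ⟨z, -, hz⟩ := Finset.exists_ne_zero_of_sum_ne_zero h
      have h1 := ih z (left_ne_zero_of_mul hz)
      have h2 := right_ne_zero_of_mul hz
      rw [matNK_apply] at h2
      simp only [ne_eq, ite_eq_right_iff, one_ne_zero, imp_false, not_not] at h2
      omega
  refine ⟨∑ l, blockSize s l, ?_⟩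
  ext x y
  by_contra hxy
  have h1 := h _ x y hxy
  have h2 := y.2.isLt
  have h3 : blockSize s y.1 ≤ ∑ l, blockSize s l :=
    Finset.single_le_sum (f := blockSize s) (fun _ _ => Nat.zero_le _) (Finset.mem_univ y.1)
  omega

theorem dRho_map : (dRho F s).map (toK F) = (RatFunc.X : RatFunc F) • 1 + matNK F s := by
  ext x y
  simp only [dRho, Matrix.map_apply, Matrix.add_apply, Matrix.smul_apply, smul_eq_mul, map_add,
    map_mul, RatFunc.algebraMap_X, Matrix.one_apply, apply_ite (toK F), map_one, map_zero]

variable [Fintype F]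

theorem matNK_map_frob (i : ℕ) : (matNK F s).map (frob F i) = matNK F s := by
  ext x y
  rw [Matrix.map_apply, matNK_apply]
  split_ifs <;> simp

theorem dRho_map_frob (i : ℕ) : ((dRho F s).map (toK F)).map (frob F i) =
    (RatFunc.X ^ Fintype.card F ^ i : RatFunc F) • 1 + matNK F s := by
  rw [dRho_map]
  conv_rhs => rw [← matNK_map_frob s i]
  ext x y
  simp only [Matrix.map_apply, Matrix.add_apply, Matrix.smul_apply, smul_eq_mul, map_add,
    map_mul, Matrix.one_apply, apply_ite (frob F i), map_one, map_zero]
  rw [frob_apply]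

/-- `θ - θ^(q^i)` in `k`. -/
abbrev lamK (F : Type*) [Field F] [Fintype F] (i : ℕ) : RatFunc F := toK F (lam F i)

theorem lamK_eq (i : ℕ) : lamK F i = RatFunc.X - RatFunc.X ^ Fintype.card F ^ i := by
  simp [lamK, lam]

theorem lamK_ne_zero {i : ℕ} (hi : i ≠ 0) : lamK F i ≠ 0 := by
  simpa using lam_ne_zero hi

theorem dRho_mul_sub_mul_dRho (R : Matrix (Idx s) (Idx s) (RatFunc F)) (i : ℕ) :
    (dRho F s).map (toK F) * R - R * ((dRho F s).map (toK F)).map (frob F i) =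
      lamK F i • R + (matNK F s * R - R * matNK F s) := by
  rw [dRho_map_frob, dRho_map, lamK_eq, add_mul, mul_add, smul_mul_assoc, one_mul, mul_smul_comm,
    mul_one, sub_smul]
  abel

theorem rhoSeries_comp_zero (Q : TauSeries F (Idx s)) :
    (rhoSeries s u).comp Q 0 = (dRho F s).map (toK F) * Q 0 := by
  rw [TauSeries.comp_apply, Finset.Nat.antidiagonal_zero, Finset.sum_singleton, frob_zero]
  rfl

theorem rhoSeries_comp_succ (Q : TauSeries F (Idx s)) (n : ℕ) :
    (rhoSeries s u).comp Q (n + 1) =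
      (dRho F s).map (toK F) * Q (n + 1) + matEK s u * (Q n).map (frob F 1) := by
  rw [TauSeries.comp_apply, Finset.Nat.sum_antidiagonal_succ]
  congr 1
  rw [Finset.sum_eq_single (0, n)]
  · rfl
  · rintro ⟨a, b⟩ hx h
    obtain _ | a := a
    · simp only [Finset.HasAntidiagonal.mem_antidiagonal, zero_add] at hx
      exact absurd (by rw [hx]) h
    · exact zero_mul _
  · simp

theorem comp_rhoSeries_zero (P : TauSeries F (Idx s)) :
    P.comp (rhoSeries s u) 0 = P 0 * ((dRho F s).map (toK F)).map (frob F 0) := by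
  rw [TauSeries.comp_apply, Finset.Nat.antidiagonal_zero, Finset.sum_singleton]
  rfl

theorem comp_rhoSeries_succ (P : TauSeries F (Idx s)) (n : ℕ) :
    P.comp (rhoSeries s u) (n + 1) =
      P (n + 1) * ((dRho F s).map (toK F)).map (frob F (n + 1)) +
        P n * (matEK s u).map (frob F n) := by
  rw [TauSeries.comp_apply, Finset.Nat.sum_antidiagonal_succ']
  congr 1
  rw [Finset.sum_eq_single (n, 0)]
  · rfl
  · rintro ⟨a, b⟩ hx h
    obtain _ | b := b
    · simp only [Finset.HasAntidiagonal.mem_antidiagonal, add_zero] at hx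
      exact absurd (by rw [hx]) h
    · change P a * (0 : Matrix _ _ (RatFunc F)).map (frob F a) = 0
      rw [Matrix.map_zero _ (map_zero _), mul_zero]
  · simp

/-- The series `R` with `R 0 = 1` and `Λ_(n+1) R (n+1) + [N, R (n+1)] = f n (R n)`. -/
theorem existsUnique_series (f : ℕ → Matrix (Idx s) (Idx s) (RatFunc F) →
    Matrix (Idx s) (Idx s) (RatFunc F)) :
    ∃! R : TauSeries F (Idx s), R 0 = 1 ∧ ∀ n,
      lamK F (n + 1) • R (n + 1) + (matNK F s * R (n + 1) - R (n + 1) * matNK F s) = f n (R n) := by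
  have hb (n : ℕ) := bijective_smul_add_commutator (isNilpotent_matNK (F := F) s)
    (lamK_ne_zero (F := F) n.succ_ne_zero)
  choose g hg using fun n => (hb n).2
  refine ⟨fun n => Nat.rec 1 (fun n R => g n (f n R)) n, ⟨rfl, fun n => hg n _⟩, ?_⟩
  rintro R ⟨h0, h⟩
  ext1 n
  induction n with
  | zero => exact h0
  | succ n ih => exact (hb n).1 ((h n).trans (by rw [ih]; exact (hg n _).symm))

/-- The logarithmic functional equation `∂ρ_t ∘ P = P ∘ ρ_t` with `P = 1 + ⋯`, coefficientwise. -/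
def LogRec (P : TauSeries F (Idx s)) : Prop :=
  P 0 = 1 ∧ ∀ n, lamK F (n + 1) • P (n + 1) + (matNK F s * P (n + 1) - P (n + 1) * matNK F s) =
    P n * (matEK s u).map (frob F n)

theorem dRho_comp_eq_iff (P : TauSeries F (Idx s)) (h0 : P 0 = 1) :
    (TauSeries.const (dRho F s)).comp P = P.comp (rhoSeries s u) ↔ LogRec s u P := by
  simp only [LogRec, h0, true_and, funext_iff]
  have h (n : ℕ) : (TauSeries.const (dRho F s)).comp P (n + 1) = P.comp (rhoSeries s u) (n + 1) ↔
      lamK F (n + 1) • P (n + 1) + (matNK F s * P (n + 1) - P (n + 1) * matNK F s) =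
        P n * (matEK s u).map (frob F n) := by
    rw [TauSeries.const_comp, comp_rhoSeries_succ, ← dRho_mul_sub_mul_dRho, sub_eq_iff_eq_add']
  constructor
  · exact fun H n => (h n).1 (H (n + 1))
  · rintro H (_ | n)
    · rw [TauSeries.const_comp, comp_rhoSeries_zero, h0, frob_zero]
      simp
    · exact (h n).2 (H n)

variable {s u}

/-- Composing `Q ∘ ∂ρ_t = ρ_t ∘ Q` with `P` on both sides turns the exponential equation into the
logarithmic one. -/
theorem IsLog.logRec {P : TauSeries F (Idx s)} (hP : IsLog s u P) : LogRec s u P := by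
  obtain ⟨Q, ⟨hQ0, hQ⟩, h1, h2⟩ := hP
  have h0 : P 0 = 1 := by
    have := congrFun h1 0
    rw [TauSeries.comp_apply, Finset.Nat.antidiagonal_zero, Finset.sum_singleton, frob_zero,
      hQ0] at this
    simpa [TauSeries.const] using this
  rw [← dRho_comp_eq_iff _ _ _ h0]
  calc (TauSeries.const (dRho F s)).comp P
      = (P.comp Q).comp ((TauSeries.const (dRho F s)).comp P) := by rw [h1, TauSeries.one_comp]
    _ = P.comp ((Q.comp (TauSeries.const (dRho F s))).comp P) := by
      simp only [TauSeries.comp_assoc]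
    _ = (P.comp (rhoSeries s u)).comp (Q.comp P) := by rw [hQ]; simp only [TauSeries.comp_assoc]
    _ = P.comp (rhoSeries s u) := by rw [h2, TauSeries.comp_one]

/-- Commutation is a recursion with a unique solution once `R 0 = 1`, and the constant series `1`
solves it. -/
theorem eq_one_of_commute_dRho {R : TauSeries F (Idx s)} (h0 : R 0 = 1)
    (h : (TauSeries.const (dRho F s)).comp R = R.comp (TauSeries.const (dRho F s))) :
    R = TauSeries.const 1 := by
  refine (existsUnique_series s fun _ _ => 0).unique ⟨h0, fun n => ?_⟩ ⟨?_, fun n => ?_⟩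
  · rw [← dRho_mul_sub_mul_dRho, sub_eq_zero, ← TauSeries.const_comp, h, TauSeries.comp_const]
  · simp [TauSeries.const]
  · simp [TauSeries.const]

theorem eq_one_of_commute_rho {R : TauSeries F (Idx s)} (h0 : R 0 = 1)
    (h : (rhoSeries s u).comp R = R.comp (rhoSeries s u)) : R = TauSeries.const 1 := by
  refine (existsUnique_series s fun n R => R * (matEK s u).map (frob F n) -
    matEK s u * R.map (frob F 1)).unique ⟨h0, fun n => ?_⟩ ⟨?_, fun n => ?_⟩
  · have := congrFun h (n + 1)
    rw [rhoSeries_comp_succ, comp_rhoSeries_succ] at this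
    rw [← dRho_mul_sub_mul_dRho, sub_eq_sub_iff_add_eq_add, this]
    abel
  · simp [TauSeries.const]
  · obtain _ | n := n
    · simp [TauSeries.const, frob_zero]
    · simp [TauSeries.const]

variable (s u) in
-- The logarithm `P` and the exponential `Q` are built separately from their recursions. Then `P ∘
-- Q` commutes with `∂ρ_t` and `Q ∘ P` with `ρ_t`, so rigidity makes both the identity.
theorem exists_isLog : ∃ P, IsLog s u P := by
  obtain ⟨P, hP, -⟩ := existsUnique_series s fun n R => R * (matEK s u).map (frob F n)
  obtain ⟨Q, ⟨hQ0, hQ⟩, -⟩ := existsUnique_series s fun _ R => -(matEK s u * R.map (frob F 1))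
  have hP' := (dRho_comp_eq_iff s u P hP.1).2 hP
  have hQ' : Q.comp (TauSeries.const (dRho F s)) = (rhoSeries s u).comp Q := by
    ext1 n
    obtain _ | n := n
    · rw [TauSeries.comp_const, rhoSeries_comp_zero, hQ0, frob_zero]
      simp
    · have := hQ n
      rw [← dRho_mul_sub_mul_dRho, ← TauSeries.comp_const, sub_eq_iff_eq_add] at this
      rw [rhoSeries_comp_succ, this]
      abel
  have hz (A B : TauSeries F (Idx s)) (hA : A 0 = 1) (hB : B 0 = 1) : A.comp B 0 = 1 := by
    rw [TauSeries.comp_apply, Finset.Nat.antidiagonal_zero, Finset.sum_singleton, frob_zero, hA, hB]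
    simp
  refine ⟨P, Q, ⟨hQ0, hQ'⟩, eq_one_of_commute_dRho (hz _ _ hP.1 hQ0) ?_,
    eq_one_of_commute_rho (u := u) (hz _ _ hQ0 hP.1) ?_⟩
  · rw [← TauSeries.comp_assoc, hP', TauSeries.comp_assoc, ← hQ', TauSeries.comp_assoc]
  · rw [← TauSeries.comp_assoc, ← hQ', TauSeries.comp_assoc, hP', TauSeries.comp_assoc]

end

/-! ### Convergence of the logarithm -/

section

variable {F : Type*} [Field F] (v : F[X]) (hv : Irreducible v) {ι : Type*} [Fintype ι]

/-- All entries of the matrix have valuation at most `exp b`. -/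
def EntryBound (b : ℤ) (R : Matrix ι ι (RatFunc F)) : Prop :=
  ∀ x y, val v hv (R x y) ≤ WithZero.exp b

variable {v hv}

omit [Fintype ι] in
theorem EntryBound.mono {b b' : ℤ} (h : b ≤ b') {R : Matrix ι ι (RatFunc F)}
    (hR : EntryBound v hv b R) : EntryBound v hv b' R :=
  fun x y => (hR x y).trans (WithZero.exp_le_exp.2 h)

omit [Fintype ι] in
theorem EntryBound.sub {b : ℤ} {R S : Matrix ι ι (RatFunc F)} (hR : EntryBound v hv b R)
    (hS : EntryBound v hv b S) : EntryBound v hv b (R - S) :=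
  fun x y => Valuation.map_sub_le _ (hR x y) (hS x y)

theorem EntryBound.mul {b c : ℤ} {R S : Matrix ι ι (RatFunc F)} (hR : EntryBound v hv b R)
    (hS : EntryBound v hv c S) : EntryBound v hv (b + c) (R * S) := by
  intro x y
  rw [Matrix.mul_apply]
  refine Valuation.map_sum_le (val v hv) fun z _ => ?_
  rw [map_mul, WithZero.exp_add]
  exact mul_le_mul' (hR x z) (hS z y)

omit [Fintype ι] in
theorem EntryBound.smul {b c : ℤ} {R : Matrix ι ι (RatFunc F)} (hR : EntryBound v hv b R)
    {a : RatFunc F} (ha : val v hv a ≤ WithZero.exp c) : EntryBound v hv (c + b) (a • R) := by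
  intro x y
  rw [Matrix.smul_apply, smul_eq_mul, map_mul, WithZero.exp_add]
  exact mul_le_mul' ha (hR x y)

omit [Fintype ι] in
theorem entryBound_map (M : Matrix ι ι F[X]) : EntryBound v hv 0 (M.map (toK F)) :=
  fun _ _ => val_toK_le_one v hv _

omit [Fintype ι] in
theorem entryBound_map_frob [Fintype F] (M : Matrix ι ι F[X]) (i : ℕ) :
    EntryBound v hv 0 ((M.map (toK F)).map (frob F i)) := by
  intro x y
  rw [Matrix.map_apply, Matrix.map_apply, frob_apply, ← map_pow]
  exact val_toK_le_one v hv _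

/-- Solutions of `a R + [N, R] = S` with nilpotent `N` are not much larger than `S`. -/
theorem EntryBound.of_smul_add_commutator [DecidableEq ι] {N : Matrix ι ι (RatFunc F)}
    (hN : EntryBound v hv 0 N) {m : ℕ}
    (hm : (LinearMap.mulLeft (RatFunc F) N - LinearMap.mulRight (RatFunc F) N) ^ m = 0)
    {a : RatFunc F} (ha0 : a ≠ 0) (ha : val v hv a⁻¹ ≤ WithZero.exp 1) {b : ℤ}
    {R S : Matrix ι ι (RatFunc F)} (hS : EntryBound v hv b S)
    (h : a • R + (N * R - R * N) = S) : EntryBound v hv (b + m) R := by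
  set D := LinearMap.mulLeft (RatFunc F) N - LinearMap.mulRight (RatFunc F) N with hD
  have hDb {c : ℤ} {T : Matrix ι ι (RatFunc F)} (hT : EntryBound v hv c T) :
      EntryBound v hv c (D T) := by
    change EntryBound v hv c (N * T - T * N)
    simpa using (hN.mul hT).sub ((hT.mul hN).mono (by simp))
  have hDS (k : ℕ) : EntryBound v hv b ((D ^ k) S) := by
    induction k with
    | zero => simpa using hS
    | succ k ih =>
      rw [pow_succ', Module.End.mul_apply]
      exact hDb ih
  have h' : a • R + D R = S := h
  -- Start from `D^m R = 0` and descend: `D^k R = a⁻¹ (D^k S - D^(k+1) R)` costs one factor `exp 1`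
  -- for each of the `m` steps.
  have key (j : ℕ) (hj : j ≤ m) : EntryBound v hv (b + j) ((D ^ (m - j)) R) := by
    induction j with
    | zero =>
      rw [Nat.sub_zero, hm]
      intro x y
      simp
    | succ j ih =>
      obtain ⟨k, hk⟩ : ∃ k, m = k + (j + 1) := ⟨m - (j + 1), by omega⟩
      have e1 : m - (j + 1) = k := by omega
      have e2 : m - j = k + 1 := by omega
      rw [e1]
      have ih' := ih (by omega)
      rw [e2, pow_succ, Module.End.mul_apply] at ih'
      have h2 : (D ^ k) R = a⁻¹ • ((D ^ k) S - (D ^ k) (D R)) := by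
        rw [← h', map_add, add_sub_cancel_right, map_smul, smul_smul, inv_mul_cancel₀ ha0,
          one_smul]
      rw [h2]
      exact ((((hDS k).mono (by omega)).sub ih').smul ha).mono (by push_cast; omega)
  simpa using key m le_rfl

end

section

variable {F : Type*} [Field F] [Fintype F] {v : F[X]} {hv : Irreducible v} {r : ℕ}
  {s : Fin (r + 1) → ℕ+} {u : Fin (r + 1) → F[X]}

/-- Each step of the recursion costs at most the nilpotency index `m` of `[N, ·]`. This bound is
crude, but linear growth suffices for convergence against `z^(q^i)`. -/
theorem LogRec.exists_entryBound {P : TauSeries F (Idx s)} (hP : LogRec s u P) :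
    ∃ C : ℕ, ∀ n : ℕ, EntryBound v hv (C * n) (P n) := by
  obtain ⟨m, hm⟩ : IsNilpotent (LinearMap.mulLeft (RatFunc F) (matNK F s) -
      LinearMap.mulRight (RatFunc F) (matNK F s)) := by
    refine (LinearMap.commute_mulLeft_right _ _).isNilpotent_sub ?_ ?_
    · rw [LinearMap.isNilpotent_mulLeft_iff]
      exact isNilpotent_matNK s
    · rw [LinearMap.isNilpotent_mulRight_iff]
      exact isNilpotent_matNK s
  refine ⟨m, fun n => ?_⟩
  induction n with
  | zero =>
    rw [hP.1]
    intro x y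
    rw [Matrix.one_apply]
    split_ifs <;> simp
  | succ n ih =>
    have hl : val v hv (lamK F (n + 1))⁻¹ ≤ WithZero.exp 1 := by
      refine (val_lam_inv_le v hv n.succ_ne_zero).trans (WithZero.exp_le_exp.2 ?_)
      split_ifs <;> simp
    refine (EntryBound.of_smul_add_commutator (entryBound_map _) hm (lamK_ne_zero n.succ_ne_zero) hl
      (ih.mul (entryBound_map_frob (matE s u) n)) (hP.2 n)).mono ?_
    push_cast
    linarith

variable (v hv s u) in
theorem exists_isLogValue {z : Idx s → F[X]} (hz : ∀ c, v ∣ z c) :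
    ∃ y, IsLogValue v hv s u z y := by
  obtain ⟨P, hP⟩ := exists_isLog s u
  obtain ⟨C, hC⟩ := hP.logRec.exists_entryBound (v := v) (hv := hv)
  have hsum : Summable (fun (i : ℕ) (c : Idx s) => toKv v hv
      ((P i *ᵥ fun b => toK F (z b) ^ (Fintype.card F) ^ i) c)) := by
    rw [Pi.summable]
    intro c
    refine summable_of_valued_le (tendsto_card_pow_sub F C) fun i => ?_
    rw [valued_toKv]
    refine Valuation.map_sum_le (val v hv) fun b _ => ?_
    rw [map_mul, neg_sub, sub_eq_add_neg, WithZero.exp_add]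
    refine mul_le_mul' (hC i c b) ?_
    change val v hv (toK F (z b) ^ (Fintype.card F) ^ i) ≤ _
    rw [← map_pow (toK F)]
    exact_mod_cast (val_toK_le_exp_iff v hv _ _).2 (pow_dvd_pow_of_dvd (hz b) _)
  exact hsum.imp fun y hy => ⟨P, hP, hy⟩

end

/-! ### The row of the logarithm that defines the polylogarithms -/

section

variable {F : Type*} [Field F] [Fintype F]

omit [Fintype F] in
/-- The list `[x (m - 1), …, x 0]`. -/
def word (x : ℕ → ℕ+ × F[X]) : ℕ → List (ℕ+ × F[X])
  | 0 => []
  | m + 1 => x m :: word x m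

theorem starSum_succ_cons (x : ℕ+ × F[X]) (c : List (ℕ+ × F[X])) (n : ℕ) :
    starSum (x :: c) (n + 1) = starSum (x :: c) n + term x n * starSum c (n + 1) :=
  sumOp_succ _ _ _

/-- Sort the terms by which outer letters have index equal to `n`: those from `x l` on do, and the
remaining `x (l - 1), …, x 0` form a star sum with indices below `n`. -/
theorem starSum_word_succ (x : ℕ → ℕ+ × F[X]) (m n : ℕ) :
    starSum (word x m) (n + 1) =
      ∑ l ∈ Finset.range (m + 1), starSum (word x l) n * ∏ e ∈ Finset.Ico l m, term (x e) n := by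
  induction m with
  | zero => simp [word, starSum]
  | succ m ih =>
    rw [word, starSum_succ_cons, ih, Finset.sum_range_succ _ (m + 1), Finset.mul_sum, add_comm]
    congr 1
    · refine Finset.sum_congr rfl fun l hl => ?_
      rw [Finset.prod_Ico_succ_top (Finset.mem_range_succ_iff.1 hl)]
      ring
    · simp [word]

theorem starSum_word_zero (x : ℕ → ℕ+ × F[X]) (m : ℕ) :
    starSum (word x m) 0 = if m = 0 then 1 else 0 := by
  obtain _ | m := m
  · rfl
  · exact sumOp_zero _ _

omit [Fintype F] in
theorem weight_word (x : ℕ → ℕ+ × F[X]) (m : ℕ) :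
    weight (word x m) = ∑ e ∈ Finset.range m, ((x e).1 : ℕ) := by
  induction m with
  | zero => rfl
  | succ m ih => rw [word, weight, ih, Finset.sum_range_succ, add_comm]

variable {r : ℕ} (s : Fin (r + 1) → ℕ+) (u : Fin (r + 1) → F[X])

omit [Fintype F] in
theorem matEK_apply (x y : Idx s) :
    matEK s u x y = toK F (if x.1 ≤ y.1 ∧ (x.2 : ℕ) + 1 = blockSize s x.1 ∧ (y.2 : ℕ) = 0 then
      (-1) ^ ((y.1 : ℕ) - (x.1 : ℕ)) * ∏ e ∈ Finset.Ico x.1 y.1, u e else 0) := rfl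

omit [Fintype F] in
/-- The letters `(s_e, u_e)`, extended by a default letter. -/
def letter (e : ℕ) : ℕ+ × F[X] :=
  if h : e < r + 1 then (s ⟨e, h⟩, u ⟨e, h⟩) else (1, 0)

omit [Fintype F] in
theorem letter_val (e : Fin (r + 1)) : letter s u e = (s e, u e) := dif_pos e.isLt

omit [Fintype F] in
theorem blockSize_eq (l : Fin (r + 1)) :
    blockSize s l = ∑ e ∈ Finset.Ico (l : ℕ) (r + 1), ((letter s u e).1 : ℕ) := by
  have h : Finset.Ico (l : ℕ) (r + 1) = (Finset.Ici l).map Fin.valEmbedding := by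
    rw [Fin.map_valEmbedding_Ici]
  rw [h, Finset.sum_map, blockSize]
  refine Finset.sum_congr rfl fun e _ => ?_
  rw [Fin.valEmbedding_apply, letter_val]

omit [Fintype F] in
theorem wt_eq : wt s = ∑ e ∈ Finset.range (r + 1), ((letter s u e).1 : ℕ) := by
  rw [wt, ← Fin.sum_univ_eq_sum_range (fun e => ((letter s u e).1 : ℕ))]
  simp only [letter_val]

omit [Fintype F] in
theorem weight_word_add_blockSize (l : Fin (r + 1)) :
    blockSize s l + weight (word (letter s u) l) = wt s := by
  rw [blockSize_eq s u, weight_word, wt_eq s u, add_comm,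
    Finset.sum_range_add_sum_Ico _ l.isLt.le]

omit [Fintype F] in
theorem blockSize_eq_add {l m : Fin (r + 1)} (h : l ≤ m) :
    blockSize s l = ∑ e ∈ Finset.Ico (l : ℕ) m, ((letter s u e).1 : ℕ) + blockSize s m := by
  rw [blockSize_eq s u, blockSize_eq s u, Finset.sum_Ico_consecutive _ h m.isLt.le]

omit [Fintype F] in
theorem prod_Ico_eq (l m : Fin (r + 1)) :
    ∏ e ∈ Finset.Ico l m, u e = ∏ e ∈ Finset.Ico (l : ℕ) m, (letter s u e).2 := by
  rw [← Fin.map_valEmbedding_Ico, Finset.prod_map]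
  refine Finset.prod_congr rfl fun e _ => ?_
  rw [Fin.valEmbedding_apply, letter_val]

omit [Fintype F] in
theorem prod_Ici_eq (l : Fin (r + 1)) :
    ∏ e ∈ Finset.Ici l, u e = ∏ e ∈ Finset.Ico (l : ℕ) (r + 1), (letter s u e).2 := by
  have h : Finset.Ico (l : ℕ) (r + 1) = (Finset.Ici l).map Fin.valEmbedding := by
    rw [Fin.map_valEmbedding_Ici]
  rw [h, Finset.prod_map]
  refine Finset.prod_congr rfl fun e _ => ?_
  rw [Fin.valEmbedding_apply, letter_val]

theorem prod_term (x : ℕ → ℕ+ × F[X]) (t : Finset ℕ) (n : ℕ) :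
    ∏ e ∈ t, term (x e) n = toK F (∏ e ∈ t, (x e).2) ^ Fintype.card F ^ n *
      (toK F (lamProd F n))⁻¹ ^ (∑ e ∈ t, ((x e).1 : ℕ)) := by
  simp only [term, Finset.prod_mul_distrib, map_prod, Finset.prod_pow, Finset.prod_pow_eq_pow_sum]

/-- The last coordinate of block `l`. -/
def lastOf (l : Fin (r + 1)) : Idx s :=
  ⟨l, ⟨blockSize s l - 1, Nat.sub_lt (blockSize_pos s l) Nat.one_pos⟩⟩

/-- The row `lastOfFirst` of the `n`-th coefficient of the logarithm. -/
def logRow (n : ℕ) (x : Idx s) : RatFunc F :=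
  (-1) ^ (x.1 : ℕ) * lamK F n ^ (blockSize s x.1 - 1 - x.2) *
    ((toK F (lamProd F n))⁻¹ ^ blockSize s x.1 * starSum (word (letter s u) x.1) n)

theorem logRow_lastOf (n : ℕ) (l : Fin (r + 1)) :
    logRow s u n (lastOf s l) = (-1) ^ (l : ℕ) *
      ((toK F (lamProd F n))⁻¹ ^ blockSize s l * starSum (word (letter s u) l) n) := by
  simp [logRow, lastOf]

theorem sum_eq_sum_lastOf {M : Type*} [AddCommMonoid M] (f : Idx s → M)
    (hf : ∀ x, (x.2 : ℕ) + 1 ≠ blockSize s x.1 → f x = 0) : ∑ x, f x = ∑ l, f (lastOf s l) := by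
  rw [Fintype.sum_sigma]
  refine Finset.sum_congr rfl fun l _ => Fintype.sum_eq_single _ fun j hj => hf _ fun h => hj ?_
  ext
  change (j : ℕ) = blockSize s l - 1
  change (j : ℕ) + 1 = blockSize s l at h
  omega

/-- Only the last coordinates of the blocks `l ≤ m` meet `E`. The signs combine to `(-1)^m`, the
products of `u_e` become products of terms at `n`, and `starSum_word_succ` raises `n` to `n + 1`. -/
theorem sum_logRow_mul_matE (n : ℕ) (m : Fin (r + 1)) (j : Fin (blockSize s m)) (hj : (j : ℕ) = 0) :
    ∑ x, logRow s u n x * frob F n (matEK s u x ⟨m, j⟩) =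
      (-1) ^ (m : ℕ) * ((toK F (lamProd F n))⁻¹ ^ blockSize s m *
        starSum (word (letter s u) m) (n + 1)) := by
  rw [sum_eq_sum_lastOf]
  · have h (l : Fin (r + 1)) : logRow s u n (lastOf s l) * frob F n (matEK s u (lastOf s l) ⟨m, j⟩) =
        if (l : ℕ) ∈ Finset.range (m + 1) then
          (-1) ^ (m : ℕ) * ((toK F (lamProd F n))⁻¹ ^ blockSize s m *
          (starSum (word (letter s u) l) n *
            ∏ e ∈ Finset.Ico (l : ℕ) m, term (letter s u e) n)) else 0 := by
      rw [logRow_lastOf, matEK_apply]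
      have h1 : ((lastOf s l).1 ≤ m ∧ ((lastOf s l).2 : ℕ) + 1 = blockSize s (lastOf s l).1 ∧
          (j : ℕ) = 0) ↔ (l : ℕ) ∈ Finset.range (m + 1) := by
        have := blockSize_pos s l
        simp only [lastOf, hj, and_true, Finset.mem_range_succ_iff, Fin.le_def]
        omega
      simp only [h1]
      split_ifs with h2
      · have h3 : l ≤ m := Finset.mem_range_succ_iff.1 h2
        change _ * frob F n (toK F ((-1) ^ ((m : ℕ) - l) * ∏ e ∈ Finset.Ico l m, u e)) = _
        rw [prod_term, ← prod_Ico_eq, blockSize_eq_add s u h3, map_mul, map_mul, map_pow, map_pow,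
          map_neg, map_neg, map_one, map_one, frob_apply, pow_add,
          ← Nat.add_sub_of_le (show (l : ℕ) ≤ m from h3), pow_add (-1)]
        simp only [Nat.add_sub_cancel_left]
        ring
      · simp
    simp only [h]
    rw [Fin.sum_univ_eq_sum_range (fun l => if l ∈ Finset.range (m + 1) then
          (-1) ^ (m : ℕ) * ((toK F (lamProd F n))⁻¹ ^ blockSize s m *
          (starSum (word (letter s u) l) n *
            ∏ e ∈ Finset.Ico (l : ℕ) m, term (letter s u e) n)) else 0),
      Finset.sum_ite_mem, Finset.inter_eq_right.2 (Finset.range_mono (by omega)),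
      starSum_word_succ, Finset.mul_sum, Finset.mul_sum]
  · intro x hx
    rw [matEK_apply, if_neg (fun h => hx h.2.1)]
    simp

variable {s u}

/-- The recursion for the row `lastOfFirst` of the logarithm. -/
theorem LogRec.row_succ {P : TauSeries F (Idx s)} (hP : LogRec s u P) (n : ℕ) (x : Idx s) :
    lamK F (n + 1) * P (n + 1) (lastOfFirst s) x -
      ∑ y, P (n + 1) (lastOfFirst s) y * matNK F s y x =
    ∑ y, P n (lastOfFirst s) y * frob F n (matEK s u y x) := by
  have h := congrFun (congrFun (hP.2 n) (lastOfFirst s)) x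
  -- The last row of a Jordan block of `N` vanishes, so the recursion closes up on this single row.
  have h0 : (matNK F s * P (n + 1)) (lastOfFirst s) x = 0 := by
    rw [Matrix.mul_apply]
    refine Finset.sum_eq_zero fun ⟨l, j⟩ _ => ?_
    rw [matNK_apply, if_neg, zero_mul]
    rintro ⟨h1, h2⟩
    obtain rfl : 0 = l := h1
    have h3 := j.isLt
    simp only [lastOfFirst] at h2
    omega
  rw [Matrix.add_apply, Matrix.sub_apply, h0, zero_sub, ← sub_eq_add_neg] at h
  exact h

omit [Fintype F] in
theorem sum_mul_matNK (f : Idx s → RatFunc F) (m : Fin (r + 1)) (j : ℕ) (hj : j < blockSize s m) :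
    ∑ y, f y * matNK F s y ⟨m, ⟨j, hj⟩⟩ =
      if h : 0 < j then f ⟨m, ⟨j - 1, by omega⟩⟩ else 0 := by
  split_ifs with h
  · rw [Fintype.sum_eq_single ⟨m, ⟨j - 1, by omega⟩⟩]
    · rw [matNK_apply, if_pos ⟨rfl, by simp only; omega⟩, mul_one]
    · rintro ⟨l, i⟩ hy
      rw [matNK_apply, if_neg, mul_zero]
      rintro ⟨h1, h2⟩
      obtain rfl : l = m := h1
      refine hy ?_
      congr 1
      ext
      simp only at h2 ⊢
      omega
  · refine Finset.sum_eq_zero fun y _ => ?_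
    rw [matNK_apply, if_neg, mul_zero]
    rintro ⟨_, h2⟩
    simp only at h2
    omega

/-- Within a block, `E` determines the column at position `0`, and each further column is the
previous one divided by `λ_(n+1)`. This accounts for the exponent `d_ℓ - 1 - j` in `logRow`. -/
theorem LogRec.row_eq {P : TauSeries F (Idx s)} (hP : LogRec s u P) (n : ℕ) :
    P n (lastOfFirst s) = logRow s u n := by
  induction n with
  | zero =>
    ext ⟨l, j⟩
    rw [hP.1, Matrix.one_apply, logRow, starSum_word_zero]
    -- As `λ_0 = 0`, only exponent `0` survives in block `0`, which leaves the identity row; in the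
    -- other blocks the empty star sum vanishes.
    have hl : lamK F 0 = 0 := by simp [lam]
    have hj := j.isLt
    by_cases h0 : l = 0
    · subst h0
      by_cases hj0 : blockSize s 0 - 1 - (j : ℕ) = 0
      · have : j = ⟨blockSize s 0 - 1, Nat.sub_lt (blockSize_pos s 0) Nat.one_pos⟩ := by
          ext
          simp only
          omega
        rw [if_pos (by rw [this]; rfl)]
        simp [hj0, lamProd_zero]
      · rw [if_neg, hl, zero_pow hj0]
        · simp
        · intro h
          rw [lastOfFirst, Sigma.mk.injEq] at h
          have := congrArg Fin.val (eq_of_heq h.2)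
          simp only at this
          omega
    · rw [if_neg, if_neg]
      · simp
      · simpa using h0
      · exact fun h => h0 (congrArg Sigma.fst h).symm
  | succ n ih =>
    ext ⟨m, j, hj⟩
    have hlam : lamK F (n + 1) ≠ 0 := lamK_ne_zero n.succ_ne_zero
    induction j with
    | zero =>
      have h := hP.row_succ n ⟨m, ⟨0, hj⟩⟩
      rw [sum_mul_matNK, dif_neg (lt_irrefl 0), sub_zero, ih, sum_logRow_mul_matE s u n m _ rfl] at h
      refine mul_left_cancel₀ hlam (h.trans ?_)
      simp only [logRow, lamProd_succ, map_mul, mul_inv, mul_pow, Nat.sub_zero]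
      obtain ⟨d, hd⟩ : ∃ d, blockSize s m = d + 1 := ⟨_, (Nat.succ_pred_eq_of_pos hj).symm⟩
      rw [hd, Nat.add_sub_cancel]
      change (-1) ^ (m : ℕ) * ((toK F (lamProd F n))⁻¹ ^ (d + 1) * _) = lamK F (n + 1) *
        ((-1) ^ (m : ℕ) * lamK F (n + 1) ^ d * ((toK F (lamProd F n))⁻¹ ^ (d + 1) *
          (lamK F (n + 1))⁻¹ ^ (d + 1) * _))
      have e : lamK F (n + 1) * lamK F (n + 1) ^ d * (lamK F (n + 1))⁻¹ ^ (d + 1) = 1 := by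
        rw [← pow_succ', ← mul_pow, mul_inv_cancel₀ hlam, one_pow]
      linear_combination (-((-1) ^ (m : ℕ) * ((toK F (lamProd F n))⁻¹ ^ (d + 1) *
        starSum (word (letter s u) m) (n + 1)))) * e
    | succ j ihj =>
      have h := hP.row_succ n ⟨m, ⟨j + 1, hj⟩⟩
      have hE : ∑ y, P n (lastOfFirst s) y * frob F n (matEK s u y ⟨m, ⟨j + 1, hj⟩⟩) = 0 := by
        refine Finset.sum_eq_zero fun y _ => ?_
        rw [matEK_apply, if_neg]
        · simp
        · rintro ⟨_, _, h3⟩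
          exact absurd h3 j.succ_ne_zero
      rw [sum_mul_matNK, dif_pos j.succ_pos, hE, sub_eq_zero] at h
      refine mul_left_cancel₀ hlam (h.trans ((ihj (by omega)).trans ?_))
      simp only [logRow]
      have : blockSize s m - 1 - j = (blockSize s m - 1 - (j + 1)) + 1 := by omega
      rw [this, pow_succ]
      ring

end

/-! ### Partial sums of the logarithm as star sums -/

section

variable {F : Type*} [Field F] [Fintype F] {v : F[X]}

/-- A factor `λ_i` is removed through `λ_i y^(q^i) = θ y^(q^i) - (θ y)^(q^i)`, which keeps the
argument divisible by `v`. -/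
theorem sum_lam_pow_mem {y : F[X]} (hy : v ∣ y) (d : ℕ+) (e : ℕ) (c : List (ℕ+ × F[X])) :
    (fun n => ∑ i ∈ Finset.range n, lamK F i ^ e * toK F y ^ Fintype.card F ^ i *
      ((toK F (lamProd F i))⁻¹ ^ (d : ℕ) * starSum c i)) ∈ smallStarSpan v (d + weight c) := by
  induction e generalizing y with
  | zero =>
    cases c with
    | nil =>
      convert! starSum_mem_small (x := (d, y)) hy [] rfl using 1
      ext n
      simp [starSum, sumOp, term]
    | cons x c =>
      -- Here the inner indices are strictly below `i`; the star sum also allows equality, and the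
      -- merged letter removes that excess.
      have h1 := sumOp_mem_small (x := (d, y)) hy (starSum_mem (x :: c) rfl) rfl
      have h2 := sumOp_mem_small (x := merge (d, y) x) (hy.mul_right _) (starSum_mem c rfl) rfl
      rw [show (d : ℕ) + weight (x :: c) = ((merge (d, y) x).1 : ℕ) + weight c by
        simp only [merge, weight, PNat.add_coe]; ring] at h1 ⊢
      convert! sub_mem h1 h2 using 1
      ext n
      simp only [Pi.sub_apply, sumOp, LinearMap.coe_mk, AddHom.coe_mk]
      rw [← Finset.sum_sub_distrib]
      refine Finset.sum_congr rfl fun i _ => ?_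
      rw [starSum_succ_cons, term_merge, pow_zero, term]
      ring
  | succ e ih =>
    convert! sub_mem (Submodule.smul_mem _ (X : F[X]) (ih hy)) (ih (hy.mul_left X)) using 1
    ext n
    simp only [Pi.sub_apply, Pi.smul_apply]
    rw [Algebra.smul_def, Finset.mul_sum, ← Finset.sum_sub_distrib]
    refine Finset.sum_congr rfl fun i _ => ?_
    rw [pow_succ, map_mul, mul_pow]
    conv_lhs => rw [lamK_eq]
    simp only [RatFunc.algebraMap_X]
    rw [lamK_eq]
    ring

variable {r : ℕ} (s : Fin (r + 1) → ℕ+) (u : Fin (r + 1) → F[X])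

/-- The `i`-th term of the `lastOfFirst` coordinate of the logarithm at `z`. -/
def logTerm (z : Idx s → F[X]) (i : ℕ) : RatFunc F :=
  ∑ x, logRow s u i x * toK F (z x) ^ Fintype.card F ^ i

/-- Partial sums of the `lastOfFirst` coordinate of the logarithm at `z`. -/
def logSum (z : Idx s → F[X]) (n : ℕ) : RatFunc F :=
  ∑ i ∈ Finset.range n, logTerm s u z i

theorem logSum_mem {z : Idx s → F[X]} (hz : ∀ x, v ∣ z x) :
    logSum s u z ∈ smallStarSpan v (wt s) := by
  have h : logSum s u z = ∑ x : Idx s, (-1 : F[X]) ^ (x.1 : ℕ) • fun n =>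
      ∑ i ∈ Finset.range n, lamK F i ^ (blockSize s x.1 - 1 - x.2) *
        toK F (z x) ^ Fintype.card F ^ i *
      ((toK F (lamProd F i))⁻¹ ^ blockSize s x.1 * starSum (word (letter s u) x.1) i) := by
    ext n
    rw [Finset.sum_apply]
    simp only [logSum, logTerm, Pi.smul_apply, Algebra.smul_def]
    rw [Finset.sum_comm]
    refine Finset.sum_congr rfl fun x _ => ?_
    rw [Finset.mul_sum]
    refine Finset.sum_congr rfl fun i _ => ?_
    rw [logRow, map_pow, map_neg, map_one]
    ring
  rw [h]
  refine sum_mem fun x _ => Submodule.smul_mem _ _ ?_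
  rw [← weight_word_add_blockSize s u x.1]
  exact sum_lam_pow_mem (hz x) ⟨blockSize s x.1, blockSize_pos s x.1⟩ _ _

/-! ### The functional equation of the logarithm, for partial sums and in the limit -/

theorem logRow_succ (n : ℕ) (x : Idx s) :
    lamK F (n + 1) * logRow s u (n + 1) x - ∑ y, logRow s u (n + 1) y * matNK F s y x =
      ∑ y, logRow s u n y * frob F n (matEK s u y x) := by
  obtain ⟨P, hP⟩ := exists_isLog s u
  have := hP.logRec.row_succ n x
  rwa [hP.logRec.row_eq, hP.logRec.row_eq] at this

theorem rhoT_apply (z : Idx s → F[X]) (x : Idx s) :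
    rhoT s u z x = X * z x + (matN F s *ᵥ z) x +
      ∑ y, matE s u x y * z y ^ Fintype.card F := by
  have h : (dRho F s *ᵥ z) x = X * z x + (matN F s *ᵥ z) x := by
    rw [dRho, Matrix.add_mulVec, Matrix.smul_mulVec, Matrix.one_mulVec]
    rfl
  rw [← h]
  rfl

theorem dvd_rhoT {z : Idx s → F[X]} (hz : ∀ x, v ∣ z x) (x : Idx s) : v ∣ rhoT s u z x := by
  rw [rhoT_apply]
  refine dvd_add (dvd_add ((hz x).mul_left _) ?_) ?_
  · exact Finset.dvd_sum fun y _ => (hz y).mul_left _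
  · exact Finset.dvd_sum fun y _ => (dvd_pow (hz y) Fintype.card_ne_zero).mul_left _

theorem toK_matN_mulVec_pow (z : Idx s → F[X]) (i : ℕ) (x : Idx s) :
    toK F ((matN F s *ᵥ z) x) ^ Fintype.card F ^ i =
      ∑ y, matNK F s x y * toK F (z y) ^ Fintype.card F ^ i := by
  have h : toK F ((matN F s *ᵥ z) x) = ∑ y, matNK F s x y * toK F (z y) := by
    change toK F (∑ y, matN F s x y * z y) = _
    rw [map_sum]
    simp only [map_mul, Matrix.map_apply]
  rw [h, ← frob_apply, map_sum]
  refine Finset.sum_congr rfl fun y _ => ?_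
  rw [map_mul, frob_apply i (toK F (z y))]
  congr 1
  conv_rhs => rw [← matNK_map_frob s i]
  rfl

theorem toK_rhoT_pow (z : Idx s → F[X]) (i : ℕ) (x : Idx s) :
    toK F (rhoT s u z x) ^ Fintype.card F ^ i =
      RatFunc.X ^ Fintype.card F ^ i * toK F (z x) ^ Fintype.card F ^ i +
      toK F ((matN F s *ᵥ z) x) ^ Fintype.card F ^ i +
      ∑ y, frob F i (matEK s u x y) * toK F (z y) ^ Fintype.card F ^ (i + 1) := by
  rw [rhoT_apply, ← frob_apply]
  simp only [map_add, map_mul, map_sum, map_pow]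
  simp only [frob_apply, RatFunc.algebraMap_X, ← pow_mul, pow_succ', Matrix.map_apply,
    mul_comm (Fintype.card F)]

/-- The boundary term in the functional equation of the partial sums. -/
def logDefect (z : Idx s → F[X]) (i : ℕ) : RatFunc F :=
  lamK F i * logTerm s u z i - logTerm s u (matN F s *ᵥ z) i

/-- The `θ` and `N` parts of `ρ_t` give `θ` times the term minus the defect at `i`; by the row
recursion, the `E τ` part is the defect at `i + 1`. Summation therefore telescopes. -/
theorem logTerm_rhoT (z : Idx s → F[X]) (i : ℕ) :
    logTerm s u (rhoT s u z) i =
      RatFunc.X * logTerm s u z i + (logDefect s u z (i + 1) - logDefect s u z i) := by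
  have h1 : logDefect s u z (i + 1) = ∑ x, logRow s u i x *
      ∑ y, frob F i (matEK s u x y) * toK F (z y) ^ Fintype.card F ^ (i + 1) := by
    have h2 (x : Idx s) : logRow s u i x *
        ∑ y, frob F i (matEK s u x y) * toK F (z y) ^ Fintype.card F ^ (i + 1) =
        ∑ y, (logRow s u i x * frob F i (matEK s u x y)) *
          toK F (z y) ^ Fintype.card F ^ (i + 1) := by
      rw [Finset.mul_sum]
      exact Finset.sum_congr rfl fun y _ => (mul_assoc _ _ _).symm
    simp only [h2]
    rw [Finset.sum_comm]
    simp only [← Finset.sum_mul, ← logRow_succ, sub_mul]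
    rw [Finset.sum_sub_distrib, logDefect, logTerm, logTerm, Finset.mul_sum]
    congr 1
    · exact Finset.sum_congr rfl fun y _ => (mul_assoc _ _ _).symm
    · simp only [toK_matN_mulVec_pow, Finset.mul_sum, Finset.sum_mul]
      rw [Finset.sum_comm]
      exact Finset.sum_congr rfl fun y _ => Finset.sum_congr rfl fun x _ => (mul_assoc _ _ _).symm
  rw [h1, logDefect, lamK_eq, logTerm]
  simp only [toK_rhoT_pow, mul_add, Finset.sum_add_distrib]
  have h3 : ∑ x, logRow s u i x * (RatFunc.X ^ Fintype.card F ^ i *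
      toK F (z x) ^ Fintype.card F ^ i) = RatFunc.X ^ Fintype.card F ^ i * logTerm s u z i := by
    rw [logTerm, Finset.mul_sum]
    exact Finset.sum_congr rfl fun x _ => mul_left_comm _ _ _
  rw [h3]
  simp only [logTerm]
  ring

theorem logDefect_zero (z : Idx s → F[X]) : logDefect s u z 0 = 0 := by
  obtain ⟨P, hP⟩ := exists_isLog s u
  have h (x : Idx s) : logRow s u 0 x = if lastOfFirst s = x then 1 else 0 := by
    rw [← hP.logRec.row_eq, hP.logRec.1, Matrix.one_apply]
  -- The row at `0` is the unit vector at `lastOfFirst`, where `N z` vanishes; the other part of the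
  -- defect has the factor `λ_0 = 0`.
  have hN : (matN F s *ᵥ z) (lastOfFirst s) = 0 := by
    refine Finset.sum_eq_zero fun ⟨l, j⟩ _ => ?_
    refine mul_eq_zero_of_left (if_neg ?_) _
    rintro ⟨h1, h2⟩
    obtain rfl : 0 = l := h1
    have h3 := j.isLt
    simp only [lastOfFirst] at h2
    omega
  simp [logDefect, logTerm, h, hN, lam]

theorem logSum_rhoT (z : Idx s → F[X]) (n : ℕ) :
    logSum s u (rhoT s u z) n = RatFunc.X * logSum s u z n + logDefect s u z n := by
  simp only [logSum, logTerm_rhoT, Finset.sum_add_distrib, Finset.sum_range_sub, logDefect_zero,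
    Finset.mul_sum, sub_zero]

theorem logSum_add (z z' : Idx s → F[X]) : logSum s u (z + z') = logSum s u z + logSum s u z' := by
  ext n
  simp only [logSum, logTerm, Pi.add_apply, map_add, ← frob_apply, mul_add, Finset.sum_add_distrib]

theorem logSum_smul (a : F) (z : Idx s → F[X]) (n : ℕ) :
    logSum s u (a • z) n = toK F (C a) * logSum s u z n := by
  simp only [logSum, logTerm, Finset.mul_sum, Pi.smul_apply, Polynomial.smul_eq_C_mul, map_mul,
    mul_pow]
  refine Finset.sum_congr rfl fun i _ => Finset.sum_congr rfl fun x _ => ?_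
  rw [← map_pow, ← map_pow C, FiniteField.pow_card_pow]
  ring

variable {s u} {hv : Irreducible v}

theorem tendsto_logTerm {z : Idx s → F[X]} (hz : ∀ x, v ∣ z x) :
    Tendsto (fun n => toKv v hv (logTerm s u z n)) atTop (𝓝 0) := by
  refine tendsto_zero_of_valued_le (tendsto_growth v (wt s)) fun n => ?_
  rw [valued_toKv]
  have := val_sub_le_of_mem_small v hv (logSum_mem s u hz) n
  rwa [logSum, logSum, Finset.sum_range_succ, add_sub_cancel_left] at this

theorem tendsto_logDefect {z : Idx s → F[X]} (hz : ∀ x, v ∣ z x) :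
    Tendsto (fun n => toKv v hv (logDefect s u z n)) atTop (𝓝 0) := by
  have h1 : Tendsto (fun n => toKv v hv (lamK F n * logTerm s u z n)) atTop (𝓝 0) := by
    refine tendsto_zero_of_valued_le (tendsto_growth v (wt s)) fun n => ?_
    rw [valued_toKv, map_mul]
    have := val_sub_le_of_mem_small v hv (logSum_mem s u hz) n
    rw [logSum, logSum, Finset.sum_range_succ, add_sub_cancel_left] at this
    exact (mul_le_of_le_one_left' (val_toK_le_one v hv _)).trans this
  have h2 : Tendsto (fun n => toKv v hv (logTerm s u (matN F s *ᵥ z) n)) atTop (𝓝 0) :=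
    tendsto_logTerm fun x => Finset.dvd_sum fun y _ => (hz y).mul_left _
  simpa [logDefect] using h1.sub h2

variable (s u v hv) in
/-- `y` is the `lastOfFirst` coordinate of the logarithm at `z`. -/
def IsLogCoord (z : Idx s → F[X]) (y : Kv v hv) : Prop :=
  Tendsto (fun n => toKv v hv (logSum s u z n)) atTop (𝓝 y)

theorem IsLogCoord.unique {z : Idx s → F[X]} {y y' : Kv v hv} (h : IsLogCoord v s u hv z y)
    (h' : IsLogCoord v s u hv z y') : y = y' :=
  tendsto_nhds_unique h h'

theorem IsLogCoord.rhoT {z : Idx s → F[X]} (hz : ∀ x, v ∣ z x) {y : Kv v hv}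
    (h : IsLogCoord v s u hv z y) :
    IsLogCoord v s u hv (rhoT s u z) (toKv v hv RatFunc.X * y) := by
  simp only [IsLogCoord, logSum_rhoT, map_add, map_mul]
  simpa using (h.const_mul (toKv v hv RatFunc.X)).add (tendsto_logDefect hz)

theorem IsLogCoord.rho {z : Idx s → F[X]} (hz : ∀ x, v ∣ z x) {y : Kv v hv}
    (h : IsLogCoord v s u hv z y) (a : F[X]) :
    (∀ x, v ∣ rho s u a z x) ∧ IsLogCoord v s u hv (rho s u a z) (toKv v hv (toK F a) * y) := by
  induction a using Polynomial.induction_on with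
  | C a =>
    have h1 : CMSPL.rho s u (C a) z = a • z := by simp [CMSPL.rho]
    rw [h1]
    refine ⟨fun x => ?_, ?_⟩
    · rw [Pi.smul_apply, Polynomial.smul_eq_C_mul]
      exact (hz x).mul_left _
    · simp only [IsLogCoord, logSum_smul, map_mul]
      exact h.const_mul _
  | add a b ha hb =>
    have h1 : CMSPL.rho s u (a + b) z = CMSPL.rho s u a z + CMSPL.rho s u b z := by
      simp [CMSPL.rho]
    rw [h1]
    refine ⟨fun x => dvd_add (ha.1 x) (hb.1 x), ?_⟩
    simp only [IsLogCoord, logSum_add, Pi.add_apply, map_add, add_mul]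
    exact ha.2.add hb.2
  | monomial n a ih =>
    have h1 : CMSPL.rho s u (C a * X ^ (n + 1)) z =
        CMSPL.rhoT s u (CMSPL.rho s u (C a * X ^ n) z) := by
      rw [pow_succ, ← mul_assoc, mul_comm, CMSPL.rho, map_mul, aeval_X]
      rfl
    rw [h1]
    refine ⟨dvd_rhoT s u ih.1, ?_⟩
    convert! ih.2.rhoT ih.1 using 1
    rw [← mul_assoc, ← map_mul]
    simp only [map_mul, map_pow, RatFunc.algebraMap_X, pow_succ]
    ring

theorem exists_isLogCoord {z : Idx s → F[X]} (hz : ∀ x, v ∣ z x) :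
    ∃ y, IsLogCoord v s u hv z y ∧ Valued.v y ≤ WithZero.exp (-B v (wt s)) :=
  exists_tendsto_of_mem_small hv (logSum_mem s u hz)

theorem IsLogValue.isLogCoord {z : Idx s → F[X]} {y : Idx s → Kv v hv}
    (h : IsLogValue v hv s u z y) : IsLogCoord v s u hv z (y (lastOfFirst s)) := by
  obtain ⟨P, hP, hy⟩ := h
  refine (Pi.hasSum.1 hy (lastOfFirst s)).tendsto_sum_nat.congr fun n => ?_
  rw [← map_sum]
  refine congrArg _ (Finset.sum_congr rfl fun i _ => ?_)
  change ∑ x, P i (lastOfFirst s) x * _ = _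
  rw [hP.logRec.row_eq]
  rfl

end

/-! ### Torsion of the reduction of the `t`-module -/

section

variable {F : Type*} [Field F] [Fintype F]

theorem frobeniusAlgHom_pow_apply {R : Type*} [CommRing R] [Algebra F R] (i : ℕ) (x : R) :
    (FiniteField.frobeniusAlgHom F R ^ i) x = x ^ Fintype.card F ^ i := by
  rw [AlgHom.coe_pow, FiniteField.coe_frobeniusAlgHom, pow_iterate]

variable {v : F[X]}

theorem pow_card_residue (hv : Irreducible v) (x : AdjoinRoot v) :
    x ^ Fintype.card F ^ v.natDegree = x := by
  have : Fact (Irreducible v) := ⟨hv⟩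
  have : Module.Finite F (AdjoinRoot v) := (AdjoinRoot.powerBasis hv.ne_zero).finite
  have : Finite (AdjoinRoot v) := Module.finite_of_finite F
  have := Fintype.ofFinite (AdjoinRoot v)
  have h1 : Module.finrank F (AdjoinRoot v) = v.natDegree := finrank_quotient_span_eq_natDegree
  rw [← h1, ← Module.card_eq_pow_finrank, FiniteField.pow_card]

/-- The Frobenius conjugates of the root are roots of `v`. They are distinct, since a coincidence
would give `v ∣ λ_e` with `0 < e < deg v`. -/
theorem map_residue_eq_prod (hm : v.Monic) (hv : Irreducible v) :
    v.map (algebraMap F (AdjoinRoot v)) = ∏ k ∈ Finset.range v.natDegree,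
      (X - C (AdjoinRoot.root v ^ Fintype.card F ^ k)) := by
  have : Fact (Irreducible v) := ⟨hv⟩
  have hmon : (∏ k ∈ Finset.range v.natDegree,
      (X - C (AdjoinRoot.root v ^ Fintype.card F ^ k))).Monic :=
    monic_prod_of_monic _ _ fun k _ => monic_X_sub_C _
  have hne (i j : ℕ) (hij : i < j) (hj : j < v.natDegree) :
      AdjoinRoot.root v ^ Fintype.card F ^ i ≠ AdjoinRoot.root v ^ Fintype.card F ^ j := by
    intro h
    obtain ⟨e, rfl⟩ := Nat.exists_eq_add_of_lt hij
    have h2 : AdjoinRoot.root v = AdjoinRoot.root v ^ Fintype.card F ^ (e + 1) := by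
      apply (FiniteField.frobeniusAlgHom F (AdjoinRoot v) ^ i).toRingHom.injective
      change (FiniteField.frobeniusAlgHom F (AdjoinRoot v) ^ i) _ =
        (FiniteField.frobeniusAlgHom F (AdjoinRoot v) ^ i) _
      rw [frobeniusAlgHom_pow_apply, frobeniusAlgHom_pow_apply, h, ← pow_mul, ← pow_add]
      congr 2
      omega
    have h3 : v ∣ lam F (e + 1) := by
      rw [← AdjoinRoot.mk_eq_zero, lam, map_sub, map_pow, AdjoinRoot.mk_X, sub_eq_zero]
      exact h2
    have := Nat.le_of_dvd e.succ_pos (natDegree_dvd_of_dvd_lam hv h3)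
    omega
  symm
  refine eq_of_dvd_of_natDegree_le_of_leadingCoeff ?_ ?_ ?_
  · refine Finset.prod_dvd_of_coprime ?_ fun k _ => ?_
    · intro i hi j hj hij
      rw [Finset.mem_coe, Finset.mem_range] at hi hj
      refine isCoprime_X_sub_C_of_isUnit_sub (sub_ne_zero_of_ne ?_).isUnit
      rcases lt_or_gt_of_ne hij with h | h
      · exact hne i j h hj
      · exact (hne j i h hi).symm
    · rw [dvd_iff_isRoot, IsRoot.def, eval_map_algebraMap, ← frobeniusAlgHom_pow_apply,
        aeval_algHom_apply, AdjoinRoot.aeval_eq, AdjoinRoot.mk_self, map_zero]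
  · rw [natDegree_map, natDegree_prod_of_monic _ _ fun k _ => monic_X_sub_C _]
    simp only [natDegree_X_sub_C, Finset.sum_const, Finset.card_range, smul_eq_mul, mul_one, le_rfl]
  · rw [hmon.leadingCoeff, (hm.map _).leadingCoeff]

/-- The shift of sequences. -/
def shift (K : Type*) [Field K] : Module.End K (ℕ → K) := LinearMap.funLeft K K Nat.succ

theorem shift_apply {K : Type*} [Field K] (g : ℕ → K) (n : ℕ) : shift K g n = g (n + 1) := rfl

omit [Fintype F] in
/-- Evaluating a polynomial at an endomorphism, seen through sequences of iterates. -/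
theorem aeval_shift_apply {K V : Type*} [Field K] [Algebra F K] [AddCommGroup V] [Module F V]
    (T : Module.End F V) (f : V →ₗ[F] K) (a : F[X]) (z : V) (n : ℕ) :
    aeval (shift K) (a.map (algebraMap F K)) (fun m => f ((T ^ m) z)) n =
      f ((T ^ n) (aeval T a z)) := by
  induction a using Polynomial.induction_on generalizing n with
  | C a =>
    rw [map_C, aeval_C, aeval_C, Module.algebraMap_end_apply, Module.algebraMap_end_apply,
      Pi.smul_apply, map_smul, map_smul, algebraMap_smul]
  | add a b ha hb =>
    rw [Polynomial.map_add, map_add, LinearMap.add_apply, Pi.add_apply, ha, hb, map_add,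
      LinearMap.add_apply, map_add, map_add]
  | monomial k a ih =>
    rw [pow_succ', ← mul_assoc, mul_comm (C a), mul_assoc, Polynomial.map_mul, map_X, map_mul,
      aeval_X, Module.End.mul_apply, shift_apply, ih, map_mul (aeval T) X, aeval_X,
      Module.End.mul_apply, pow_succ, Module.End.mul_apply]

/-- On a tower of sequences behaving like the coordinates of `C^{⊗ d}` over the residue field,
`v^d - 1` vanishes. -/
theorem aeval_shift_pow_sub_one (hm : v.Monic) (hv : Irreducible v) {d : ℕ}
    (c : ℕ → ℕ → AdjoinRoot v)
    (hc : ∀ j < d, ∀ n, haveI : Fact (Irreducible v) := ⟨hv⟩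
      c j (n + 1) = AdjoinRoot.root v * c j n + c (j + 1) n)
    (hd : ∀ n, c d n = c 0 n ^ Fintype.card F) {j : ℕ} (hj : j < d) :
    haveI : Fact (Irreducible v) := ⟨hv⟩
    aeval (shift (AdjoinRoot v)) ((v ^ d - 1).map (algebraMap F (AdjoinRoot v))) (c j) = 0 := by
  have : Fact (Irreducible v) := ⟨hv⟩
  -- The linear factors of `v` have coefficients in the residue field, over which `ρ_t` is not
  -- linear because of `τ`. The shift on sequences of iterates is linear over it.
  set U : (AdjoinRoot v)[X] →ₐ[AdjoinRoot v] Module.End (AdjoinRoot v) (ℕ → AdjoinRoot v) :=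
    aeval (shift (AdjoinRoot v)) with hU
  -- The case `k = 0` iterates `(shift - θ) c_j = c_(j+1)`; Frobenius twists give the other `k`. For
  -- `j = d`, each twist raises `c_0^(q^k)` to its `q`-th power.
  have hstep (k j : ℕ) (hj : j ≤ d) :
      U ((X - C (AdjoinRoot.root v ^ Fintype.card F ^ k)) ^ j)
        (fun n => c 0 n ^ Fintype.card F ^ k) = fun n => c j n ^ Fintype.card F ^ k := by
    induction j with
    | zero => simp
    | succ j ih =>
      rw [pow_succ', map_mul, Module.End.mul_apply, ih (by omega)]
      ext n
      rw [map_sub, hU, aeval_X, aeval_C, LinearMap.sub_apply, Pi.sub_apply, shift_apply,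
        Module.algebraMap_end_apply, Pi.smul_apply, smul_eq_mul, hc j (by omega),
        ← frobeniusAlgHom_pow_apply, map_add, map_mul]
      simp only [frobeniusAlgHom_pow_apply]
      ring
  have hprod (m : ℕ) : U (∏ k ∈ Finset.range m,
      (X - C (AdjoinRoot.root v ^ Fintype.card F ^ k)) ^ d) (c 0) =
      fun n => c 0 n ^ Fintype.card F ^ m := by
    induction m with
    | zero => simp
    | succ m ih =>
      rw [Finset.prod_range_succ, mul_comm, map_mul, Module.End.mul_apply, ih, hstep m d le_rfl]
      ext n
      rw [hd, ← pow_mul, ← pow_succ']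
  have h0 : U ((v ^ d - 1).map (algebraMap F (AdjoinRoot v))) (c 0) = 0 := by
    rw [Polynomial.map_sub, Polynomial.map_pow, map_residue_eq_prod hm hv, ← Finset.prod_pow,
      map_sub, LinearMap.sub_apply, hprod, Polynomial.map_one, map_one]
    ext n
    simp [pow_card_residue hv]
  -- Every `c j` is a polynomial in the shift applied to `c 0`, and such polynomials commute, so
  -- vanishing on `c 0` is enough.
  have h1 : U ((X - C (AdjoinRoot.root v)) ^ j) (c 0) = c j := by
    simpa only [pow_zero, pow_one] using hstep 0 j hj.le
  rw [← h1, ← Module.End.mul_apply, ← map_mul, mul_comm, map_mul, Module.End.mul_apply, h0,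
    map_zero]

/-! ### The filtration by blocks modulo `v` -/

variable {r : ℕ} (s : Fin (r + 1) → ℕ+) (u : Fin (r + 1) → F[X])

omit [Fintype F] in
theorem matN_mulVec_apply (z : Idx s → F[X]) (l : Fin (r + 1)) (j : ℕ) (hj : j < blockSize s l) :
    (matN F s *ᵥ z) ⟨l, ⟨j, hj⟩⟩ =
      if h : j + 1 < blockSize s l then z ⟨l, ⟨j + 1, h⟩⟩ else 0 := by
  change ∑ y, matN F s ⟨l, ⟨j, hj⟩⟩ y * z y = _
  split_ifs with h
  · rw [Fintype.sum_eq_single ⟨l, ⟨j + 1, h⟩⟩]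
    · exact (congrArg (· * _) (if_pos ⟨rfl, rfl⟩)).trans (one_mul _)
    · rintro ⟨m, i⟩ hy
      refine mul_eq_zero_of_left (if_neg ?_) _
      rintro ⟨h1, h2⟩
      obtain rfl : l = m := h1
      refine hy ?_
      congr 1
      ext
      exact h2.symm
  · refine Finset.sum_eq_zero fun ⟨m, i⟩ _ => mul_eq_zero_of_left (if_neg ?_) _
    rintro ⟨h1, h2⟩
    obtain rfl : l = m := h1
    have := i.isLt
    simp only at h2
    omega

omit [Fintype F] in
/-- The points whose blocks from the `k`-th on vanish modulo `v`. -/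
def vanishing (v : F[X]) (k : ℕ) : Submodule F (Idx s → F[X]) where
  carrier := {z | ∀ x : Idx s, k ≤ x.1 → v ∣ z x}
  add_mem' hz hz' x hx := dvd_add (hz x hx) (hz' x hx)
  zero_mem' _ _ := dvd_zero _
  smul_mem' a z hz x hx := by
    rw [Pi.smul_apply, Polynomial.smul_eq_C_mul]
    exact (hz x hx).mul_left _

theorem vanishing_le_comap (k : ℕ) :
    vanishing s v k ≤ (vanishing s v k).comap (rhoT s u) := by
  rintro z hz ⟨l, j, hj⟩ hx
  rw [rhoT_apply, matN_mulVec_apply]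
  refine dvd_add (dvd_add ((hz _ hx).mul_left _) ?_) ?_
  · split_ifs with h
    · exact hz ⟨l, _⟩ hx
    · exact dvd_zero _
  · refine Finset.dvd_sum fun y _ => ?_
    by_cases h : l ≤ y.1
    · exact (dvd_pow (hz y (le_trans hx h)) Fintype.card_ne_zero).mul_left _
    · rw [show matE s u ⟨l, ⟨j, hj⟩⟩ y = 0 from if_neg fun h' => h h'.1, zero_mul]
      exact dvd_zero _

/-- Once the later blocks vanish modulo `v`, the `k`-th block reduces to the Carlitz tensor power of
dimension `d_k`: each coordinate feeds on the next one, and the last on the `q`-th power of the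
first. -/
theorem mk_rhoT_apply {k : ℕ} {z : Idx s → F[X]} (hz : z ∈ vanishing s v (k + 1))
    (l : Fin (r + 1)) (hl : (l : ℕ) = k) (j : ℕ) (hj : j < blockSize s l) :
    AdjoinRoot.mk v (rhoT s u z ⟨l, ⟨j, hj⟩⟩) =
      AdjoinRoot.root v * AdjoinRoot.mk v (z ⟨l, ⟨j, hj⟩⟩) +
        if h : j + 1 < blockSize s l then AdjoinRoot.mk v (z ⟨l, ⟨j + 1, h⟩⟩)
        else AdjoinRoot.mk v (z ⟨l, ⟨0, blockSize_pos s l⟩⟩) ^ Fintype.card F := by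
  rw [rhoT_apply, matN_mulVec_apply, map_add, map_add, map_mul, AdjoinRoot.mk_X, add_assoc]
  congr 1
  split_ifs with h
  · have h0 : ∑ y, matE s u ⟨l, ⟨j, hj⟩⟩ y * z y ^ Fintype.card F = 0 := by
      refine Finset.sum_eq_zero fun y _ => mul_eq_zero_of_left (if_neg fun h' => ?_) _
      have := h'.2.1
      simp only at this
      omega
    rw [h0, map_zero, add_zero]
  · rw [map_zero, zero_add, map_sum, Fintype.sum_eq_single ⟨l, ⟨0, blockSize_pos s l⟩⟩]
    · have h1 : matE s u ⟨l, ⟨j, hj⟩⟩ ⟨l, ⟨0, blockSize_pos s l⟩⟩ = 1 := by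
        have h2 : j + 1 = blockSize s l := by omega
        exact (if_pos ⟨le_rfl, h2, rfl⟩).trans (by simp)
      rw [h1, one_mul, map_pow]
    · rintro ⟨m, i⟩ hy
      by_cases hlm : l < m
      · rw [AdjoinRoot.mk_eq_zero]
        have h2 : k + 1 ≤ (m : ℕ) := by
          rw [← hl]
          exact hlm
        exact (dvd_pow (hz ⟨m, i⟩ h2) Fintype.card_ne_zero).mul_left _
      · rw [show matE s u ⟨l, ⟨j, hj⟩⟩ ⟨m, i⟩ = 0 from if_neg ?_, zero_mul, map_zero]
        rintro ⟨h1, -, h3⟩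
        obtain rfl : l = m := le_antisymm h1 (not_lt.1 hlm)
        refine hy ?_
        congr 1
        ext
        exact h3

/-- If the blocks after the `l`-th vanish modulo `v`, then `v^(d_l) - 1` annihilates the `l`-th
block modulo `v`. -/
theorem rho_pow_sub_one_mem_vanishing (hm : v.Monic) (hv : Irreducible v) (l : Fin (r + 1))
    {z : Idx s → F[X]} (hz : z ∈ vanishing s v (l + 1)) :
    rho s u (v ^ blockSize s l - 1) z ∈ vanishing s v l := by
  have : Fact (Irreducible v) := ⟨hv⟩
  have hT (b : F[X]) : rho s u b z ∈ vanishing s v (l + 1) :=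
    aeval_apply_smul_mem_of_le_comap hz b _ (vanishing_le_comap s u _)
  have hpow (n : ℕ) : (rhoT s u ^ n) z ∈ vanishing s v (l + 1) := by
    simpa [rho] using hT (X ^ n)
  rintro ⟨m, j, hj⟩ hx
  rcases eq_or_lt_of_le hx with h | h
  · obtain rfl : l = m := Fin.ext h
    let f (i : ℕ) (hi : i < blockSize s l) : (Idx s → F[X]) →ₗ[F] AdjoinRoot v :=
      (AdjoinRoot.mkₐ v).toLinearMap ∘ₗ LinearMap.proj ⟨l, ⟨i, hi⟩⟩
    -- Beyond the block, `c` is defined as the `q`-th power of the first coordinate, so the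
    -- recursion also holds at the last position.
    let c (i n : ℕ) : AdjoinRoot v := if hi : i < blockSize s l then f i hi ((rhoT s u ^ n) z)
      else f 0 (blockSize_pos s l) ((rhoT s u ^ n) z) ^ Fintype.card F
    have hc (i : ℕ) (hi : i < blockSize s l) (n : ℕ) :
        c i (n + 1) = AdjoinRoot.root v * c i n + c (i + 1) n := by
      simp only [c, dif_pos hi]
      rw [pow_succ', Module.End.mul_apply]
      exact mk_rhoT_apply s u (hpow n) l rfl i hi
    have hd (n : ℕ) : c (blockSize s l) n = c 0 n ^ Fintype.card F := by
      simp only [c, dif_neg (lt_irrefl _), dif_pos (blockSize_pos s l)]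
    have h1 := congrFun (aeval_shift_pow_sub_one hm hv c hc hd hj) 0
    have h2 : c j = fun n => f j hj ((rhoT s u ^ n) z) := by
      ext n
      simp only [c, dif_pos hj]
    rw [h2, aeval_shift_apply] at h1
    exact AdjoinRoot.mk_eq_zero.1 h1
  · exact hT _ ⟨m, ⟨j, hj⟩⟩ h

/-- Starting from the last block, the factors `v^(d_ℓ) - 1` kill one block after another modulo `v`.
Each is prime to `v`, hence so is their product. -/
theorem exists_rho_dvd (hm : v.Monic) (hv : Irreducible v) (z : Idx s → F[X]) :
    ∃ a, ¬ v ∣ a ∧ ∀ x, v ∣ rho s u a z x := by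
  have h (k : ℕ) : ∃ a, ¬ v ∣ a ∧ rho s u a z ∈ vanishing s v (r + 1 - k) := by
    induction k with
    | zero =>
      exact ⟨1, fun h => hv.not_isUnit (isUnit_of_dvd_one h), fun x hx =>
        absurd (lt_of_lt_of_le x.1.isLt hx) (lt_irrefl _)⟩
    | succ k ih =>
      obtain ⟨a, ha, hz⟩ := ih
      by_cases hk : k < r + 1
      · have hl : r + 1 - k = r + 1 - (k + 1) + 1 := by omega
        let l : Fin (r + 1) := ⟨r + 1 - (k + 1), by omega⟩
        refine ⟨(v ^ blockSize s l - 1) * a, ?_, ?_⟩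
        · rw [hv.prime.dvd_mul, not_or]
          refine ⟨fun h => hv.not_isUnit (isUnit_of_dvd_one ?_), ha⟩
          exact (dvd_sub_right (dvd_pow_self v (blockSize_pos s l).ne')).1 h
        · rw [rho, map_mul]
          rw [hl] at hz
          exact rho_pow_sub_one_mem_vanishing s u hm hv l hz
      · have hl : r + 1 - k = r + 1 - (k + 1) := by omega
        exact ⟨a, ha, hl ▸ hz⟩
  obtain ⟨a, ha, hz⟩ := h (r + 1)
  exact ⟨a, ha, fun x => hz x (by omega)⟩

end

/-! ### Polylogarithms as limits of star sums -/

section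

variable {F : Type*} [Field F] [Fintype F]

/-- The `i`-th term collects the pieces of `starSum_word_succ` in which the first index equals `i`,
that is, the increment of the full star sum. -/
theorem logSum_specialPoint {r : ℕ} (s : Fin (r + 1) → ℕ+) (u : Fin (r + 1) → F[X]) (n : ℕ) :
    logSum s u (specialPoint s u) n = (-1) ^ r * starSum (word (letter s u) (r + 1)) n := by
  have h (i : ℕ) : logTerm s u (specialPoint s u) i = (-1) ^ r *
      (starSum (word (letter s u) (r + 1)) (i + 1) - starSum (word (letter s u) (r + 1)) i) := by
    have hl (l : Fin (r + 1)) : logRow s u i (lastOf s l) *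
        toK F (specialPoint s u (lastOf s l)) ^ Fintype.card F ^ i =
        (-1) ^ r * (starSum (word (letter s u) l) i *
          ∏ e ∈ Finset.Ico (l : ℕ) (r + 1), term (letter s u e) i) := by
      have h1 : specialPoint s u (lastOf s l) = (-1) ^ (r - (l : ℕ)) * ∏ e ∈ Finset.Ici l, u e :=
        if_pos (Nat.succ_pred_eq_of_pos (blockSize_pos s l))
      have hlr : (l : ℕ) ≤ r := Nat.lt_succ_iff.1 l.isLt
      rw [h1, logRow_lastOf, prod_term, ← prod_Ici_eq, ← blockSize_eq, map_mul, map_pow, map_neg,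
        map_one, ← frob_apply, map_mul, map_pow, map_neg, map_one, frob_apply]
      have h2 : (-1 : RatFunc F) ^ r = (-1) ^ (l : ℕ) * (-1) ^ (r - (l : ℕ)) := by
        rw [← pow_add, Nat.add_sub_of_le hlr]
      rw [h2]
      ring
    rw [logTerm, sum_eq_sum_lastOf]
    · simp only [hl]
      rw [Fin.sum_univ_eq_sum_range (fun l => (-1 : RatFunc F) ^ r *
        (starSum (word (letter s u) l) i *
          ∏ e ∈ Finset.Ico (l : ℕ) (r + 1), term (letter s u e) i)), starSum_word_succ,
        Finset.sum_range_succ _ (r + 1), Finset.Ico_self, Finset.prod_empty, mul_one,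
        add_sub_cancel_right, Finset.mul_sum]
    · intro x hx
      have h0 : specialPoint s u x = 0 := if_neg hx
      rw [h0, map_zero, zero_pow (pow_ne_zero _ Fintype.card_ne_zero), mul_zero]
  simp only [logSum, h]
  rw [← Finset.mul_sum, Finset.sum_range_sub, starSum_word_zero, if_neg r.succ_ne_zero, sub_zero]

omit [Fintype F] in
theorem word_eq_ofFn (x : ℕ → ℕ+ × F[X]) (m : ℕ) :
    word x m = List.ofFn fun i : Fin m => x (m - 1 - i) := by
  induction m with
  | zero => rfl
  | succ m ih =>
    rw [word, ih, List.ofFn_succ]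
    congr 2
    funext i
    congr 1
    rw [Fin.val_succ]
    omega

omit [Fintype F] in
theorem word_letter_rev {r : ℕ} (s : Fin (r + 1) → ℕ+) (u : Fin (r + 1) → F[X]) :
    word (letter (s ∘ Fin.rev) (u ∘ Fin.rev)) (r + 1) = List.ofFn fun i => (s i, u i) := by
  rw [word_eq_ofFn]
  congr 1
  funext i
  have h : r + 1 - 1 - (i : ℕ) = (Fin.rev i : Fin (r + 1)) := by
    rw [Fin.val_rev]
    omega
  rw [h, letter_val]
  simp

omit [Fintype F] in
theorem wt_rev {r : ℕ} (s : Fin (r + 1) → ℕ+) : wt (s ∘ Fin.rev) = wt s :=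
  Equiv.sum_comp Fin.revPerm fun i => (s i : ℕ)

omit [Fintype F] in
theorem wt_ne_zero {r : ℕ} (s : Fin (r + 1) → ℕ+) : wt s ≠ 0 :=
  (Finset.sum_pos (fun i _ => (s i).pos) Finset.univ_nonempty).ne'

omit [Fintype F] in
theorem weight_ofFn {r : ℕ} (s : Fin (r + 1) → ℕ+) (u : Fin (r + 1) → F[X]) :
    weight (List.ofFn fun i => (s i, u i)) = wt s := by
  rw [← word_letter_rev, weight_word, ← wt_eq, wt_rev]

omit [Fintype F] in
theorem aeval_ratFuncX (a : F[X]) : aeval (RatFunc.X : RatFunc F) a = toK F a := by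
  rw [← RatFunc.algebraMap_X, aeval_algebraMap_apply, aeval_X_left_apply]

variable {v : F[X]} {hv : Irreducible v} {r : ℕ} {s : Fin (r + 1) → ℕ+} {u : Fin (r + 1) → F[X]}

/-- An admissible `a` computes a polylogarithm value. -/
theorem exists_isLi_of_dvd {a : F[X]} (ha : a ≠ 0)
    (h : ∀ c, v ∣ rho (s ∘ Fin.rev) (u ∘ Fin.rev) a
      (specialPoint (s ∘ Fin.rev) (u ∘ Fin.rev)) c) :
    ∃ y, IsLogCoord v (s ∘ Fin.rev) (u ∘ Fin.rev) hv
        (rho (s ∘ Fin.rev) (u ∘ Fin.rev) a (specialPoint (s ∘ Fin.rev) (u ∘ Fin.rev))) y ∧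
      IsLi v hv s u (toKv v hv ((-1) ^ r / toK F a) * y) := by
  obtain ⟨y, hy⟩ := exists_isLogValue v hv (s ∘ Fin.rev) (u ∘ Fin.rev) h
  refine ⟨_, hy.isLogCoord, a, ha, fun c => (val_toK_lt_one_iff v hv _).2 (h c), y, hy, ?_⟩
  rw [aeval_ratFuncX]

theorem IsLi.exists_isLogCoord {x : Kv v hv} (hx : IsLi v hv s u x) :
    ∃ a : F[X], a ≠ 0 ∧ (∀ c, v ∣ rho (s ∘ Fin.rev) (u ∘ Fin.rev) a
        (specialPoint (s ∘ Fin.rev) (u ∘ Fin.rev)) c) ∧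
      ∃ y, IsLogCoord v (s ∘ Fin.rev) (u ∘ Fin.rev) hv
          (rho (s ∘ Fin.rev) (u ∘ Fin.rev) a (specialPoint (s ∘ Fin.rev) (u ∘ Fin.rev))) y ∧
        x = toKv v hv ((-1) ^ r / toK F a) * y := by
  obtain ⟨a, ha, h, y, hy, rfl⟩ := hx
  refine ⟨a, ha, fun c => (val_toK_lt_one_iff v hv _).1 (h c), _, hy.isLogCoord, ?_⟩
  rw [aeval_ratFuncX]

/-- The value does not depend on the choice of `a`. -/
theorem IsLi.unique {x x' : Kv v hv} (hx : IsLi v hv s u x) (hx' : IsLi v hv s u x') : x = x' := by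
  obtain ⟨a, ha, hav, y, hy, rfl⟩ := hx.exists_isLogCoord
  obtain ⟨b, hb, hbv, y', hy', rfl⟩ := hx'.exists_isLogCoord
  have h1 := (hy.rho hav b).2
  have h2 := (hy'.rho hbv a).2
  have hcomm : rho (s ∘ Fin.rev) (u ∘ Fin.rev) b (rho (s ∘ Fin.rev) (u ∘ Fin.rev) a
      (specialPoint (s ∘ Fin.rev) (u ∘ Fin.rev))) =
      rho (s ∘ Fin.rev) (u ∘ Fin.rev) a (rho (s ∘ Fin.rev) (u ∘ Fin.rev) b
      (specialPoint (s ∘ Fin.rev) (u ∘ Fin.rev))) := by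
    simp only [CMSPL.rho]
    -- `ρ_a` and `ρ_b` commute, so both values can be compared at the common point `ρ_(ab)` of the
    -- special point.
    rw [← Module.End.mul_apply, ← map_mul, mul_comm, map_mul, Module.End.mul_apply]
  rw [hcomm] at h1
  have h3 := h1.unique h2
  have ha' : toKv v hv (toK F a) ≠ 0 := by simpa using ha
  have hb' : toKv v hv (toK F b) ≠ 0 := by simpa using hb
  rw [map_div₀, map_div₀]
  field_simp
  linear_combination h3

variable (v s u) in
omit [Fintype F] in
-- After reversal `u_1` comes last, so it occurs in every product `u_ℓ ⋯ u_r`. Hence `a = 1` is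
-- admissible.
theorem dvd_specialPoint_rev (hu : v ∣ u 0) (c : Idx (s ∘ Fin.rev)) :
    v ∣ specialPoint (s ∘ Fin.rev) (u ∘ Fin.rev) c := by
  rw [specialPoint]
  split_ifs
  · refine dvd_mul_of_dvd_right (hu.trans ?_) _
    have : u 0 = (u ∘ Fin.rev) (Fin.last r) := by simp
    rw [this]
    exact Finset.dvd_prod_of_mem _ (Finset.mem_Ici.2 (Fin.le_last _))
  · exact dvd_zero _

/-- For `v ∣ u_1`, the polylogarithm value is the limit of the star sums. -/
theorem isLi_iff_tendsto (hu : v ∣ u 0) (x : Kv v hv) :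
    IsLi v hv s u x ↔
      Tendsto (fun n => toKv v hv (starSum (List.ofFn fun i => (s i, u i)) n)) atTop (𝓝 x) := by
  have h1 : rho (s ∘ Fin.rev) (u ∘ Fin.rev) 1 (specialPoint (s ∘ Fin.rev) (u ∘ Fin.rev)) =
      specialPoint (s ∘ Fin.rev) (u ∘ Fin.rev) := by
    rw [rho, map_one, Module.End.one_apply]
  obtain ⟨y, hy, hLi⟩ := exists_isLi_of_dvd (s := s) (u := u) (v := v) (hv := hv) (a := 1)
    one_ne_zero (by rw [h1]; exact dvd_specialPoint_rev v s u hu)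
  have h2 : Tendsto (fun n => toKv v hv (starSum (List.ofFn fun i => (s i, u i)) n)) atTop
      (𝓝 (toKv v hv ((-1) ^ r / toK F 1) * y)) := by
    rw [h1] at hy
    have h3 : Tendsto _ atTop _ := Tendsto.const_mul (toKv v hv ((-1) ^ r / toK F 1)) hy
    refine h3.congr fun n => ?_
    rw [logSum_specialPoint, word_letter_rev, ← map_mul, map_one, div_one, ← mul_assoc,
      ← pow_add, Even.neg_one_pow ⟨r, rfl⟩, one_mul]
  constructor
  · intro hx
    rwa [hx.unique hLi]
  · intro hx
    rwa [tendsto_nhds_unique hx h2]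

variable (v hv) in
theorem mem_Sstar_iff {w : ℕ} (hw : w ≠ 0) (x : Kv v hv) :
    x ∈ Sstar v hv w ↔ ∃ (l : ℕ+ × F[X]) (c : List (ℕ+ × F[X])), v ∣ l.2 ∧ weight (l :: c) = w ∧
      Tendsto (fun n => toKv v hv (starSum (l :: c) n)) atTop (𝓝 x) := by
  rw [Sstar, if_neg hw]
  constructor
  · rintro ⟨r, s, u, rfl, hu, hx⟩
    rw [isLi_iff_tendsto hu] at hx
    refine ⟨(s 0, u 0), List.ofFn fun i : Fin r => (s i.succ, u i.succ), hu, ?_, ?_⟩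
    · rw [← weight_ofFn s u, List.ofFn_succ]
    · rwa [List.ofFn_succ] at hx
  · rintro ⟨l, c, hl, rfl, hx⟩
    let s : Fin (c.length + 1) → ℕ+ := fun i => ((l :: c).get i).1
    let u : Fin (c.length + 1) → F[X] := fun i => ((l :: c).get i).2
    have h : (List.ofFn fun i => (s i, u i)) = l :: c := List.ofFn_get (l :: c)
    refine ⟨c.length, s, u, ?_, hl, ?_⟩
    · rw [← weight_ofFn s u, h]
    · rwa [isLi_iff_tendsto (show v ∣ u 0 from hl), h]

/-- Every generator of the small span converges by itself, so limits can be taken termwise in a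
linear combination. -/
theorem mem_span_Sstar_of_tendsto {w : ℕ} (hw : w ≠ 0) {g : ℕ → RatFunc F}
    (hg : g ∈ smallStarSpan v w) {x : Kv v hv}
    (hx : Tendsto (fun n => toKv v hv (g n)) atTop (𝓝 x)) :
    x ∈ Submodule.span (RatFunc F) (Sstar v hv w) := by
  induction hg using Submodule.span_induction generalizing x with
  | mem g hg =>
    obtain ⟨l, c, hl, hc, rfl⟩ := hg
    exact Submodule.subset_span ((mem_Sstar_iff v hv hw x).2 ⟨l, c, hl, hc, hx⟩)
  | zero =>
    have : x = 0 := tendsto_nhds_unique hx (by simp)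
    rw [this]
    exact zero_mem _
  | add g h hg hh ihg ihh =>
    obtain ⟨y, hy, -⟩ := exists_tendsto_of_mem_small hv hg
    obtain ⟨z, hz, -⟩ := exists_tendsto_of_mem_small hv hh
    have : x = y + z := tendsto_nhds_unique hx (by simpa using hy.add hz)
    rw [this]
    exact add_mem (ihg hy) (ihh hz)
  | smul a g hg ih =>
    obtain ⟨y, hy, -⟩ := exists_tendsto_of_mem_small hv hg
    have : x = toKv v hv (toK F a) * y := by
      refine tendsto_nhds_unique hx ((hy.const_mul (toKv v hv (toK F a))).congr fun n => ?_)
      rw [← map_mul, Pi.smul_apply, Algebra.smul_def]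
    rw [this, ← Algebra.smul_def]
    exact Submodule.smul_mem _ _ (ih hy)

theorem IsLi.mem_span_Sstar {x : Kv v hv} (hx : IsLi v hv s u x) :
    x ∈ Submodule.span (RatFunc F) (Sstar v hv (wt s)) := by
  obtain ⟨a, ha, hav, y, hy, rfl⟩ := hx.exists_isLogCoord
  rw [← Algebra.smul_def]
  refine Submodule.smul_mem _ _ (mem_span_Sstar_of_tendsto (wt_ne_zero s) ?_ hy)
  rw [← wt_rev s]
  exact logSum_mem _ _ hav

/-! ### Spans, products and the valuation bound -/

variable (v hv) in
theorem Sstar_subset_S (w : ℕ) : Sstar v hv w ⊆ S v hv w := by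
  rw [Sstar, S]
  split_ifs
  · exact subset_rfl
  · rintro x ⟨r, s, u, hw, -, hx⟩
    exact ⟨r, s, u, hw, hx⟩

variable (v hv) in
theorem L_eq_span_Sstar (w : ℕ) : L v hv w = Submodule.span (RatFunc F) (Sstar v hv w) := by
  refine le_antisymm (Submodule.span_le.2 fun x hx => ?_)
    (Submodule.span_mono (Sstar_subset_S v hv w))
  rw [S] at hx
  split_ifs at hx with hw
  · refine Submodule.subset_span ?_
    rwa [Sstar, if_pos hw]
  · obtain ⟨r, s, u, rfl, hx⟩ := hx
    exact hx.mem_span_Sstar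

variable (v hv) in
theorem L_zero : L v hv 0 = 1 := by
  rw [L, S, if_pos rfl, Submodule.one_eq_span]

variable (v hv) in
-- Generators may be taken in `Sstar`, where values are limits of small star sums; the quasi-shuffle
-- product then passes to the limit.
theorem L_mul_le (w w' : ℕ) : L v hv w * L v hv w' ≤ L v hv (w + w') := by
  rcases eq_or_ne w 0 with rfl | hw
  · rw [L_zero, one_mul, zero_add]
  rcases eq_or_ne w' 0 with rfl | hw'
  · rw [L_zero, mul_one, add_zero]
  rw [L_eq_span_Sstar, L_eq_span_Sstar, L_eq_span_Sstar, Submodule.span_mul_span,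
    Submodule.span_le]
  rintro _ ⟨x, hx, y, hy, rfl⟩
  obtain ⟨l, c, hl, rfl, hx'⟩ := (mem_Sstar_iff v hv hw x).1 hx
  obtain ⟨m, d, hm, rfl, hy'⟩ := (mem_Sstar_iff v hv hw' y).1 hy
  refine mem_span_Sstar_of_tendsto (by omega) (starSum_mul_mem_small hl hm c d) ?_
  simpa using hx'.mul hy'

variable (v hv s u) in
theorem existsUnique_isLi (hm : v.Monic) : ∃! x : Kv v hv, IsLi v hv s u x := by
  obtain ⟨a, ha, hav⟩ := exists_rho_dvd (s ∘ Fin.rev) (u ∘ Fin.rev) hm hv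
    (specialPoint (s ∘ Fin.rev) (u ∘ Fin.rev))
  obtain ⟨y, -, hy⟩ := exists_isLi_of_dvd (hv := hv) (a := a)
    (by rintro rfl; exact ha (dvd_zero v)) hav
  exact ⟨_, hy, fun x hx => hx.unique hy⟩

/-- By uniqueness the value can be computed with an `a` prime to `v`. Then `a(θ)` is a `v`-adic
unit, and the bound for the logarithm coordinate carries over unchanged. -/
theorem IsLi.valued_le (hm : v.Monic) {x : Kv v hv} (hx : IsLi v hv s u x) :
    Valued.v x ≤ WithZero.exp (-B v (wt s)) := by
  obtain ⟨a, ha, hav⟩ := exists_rho_dvd (s ∘ Fin.rev) (u ∘ Fin.rev) hm hv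
    (specialPoint (s ∘ Fin.rev) (u ∘ Fin.rev))
  obtain ⟨y, hy, hLi⟩ := exists_isLi_of_dvd (hv := hv) (a := a)
    (by rintro rfl; exact ha (dvd_zero v)) hav
  obtain ⟨y', hy', hle⟩ := CMSPL.exists_isLogCoord (hv := hv) (s := s ∘ Fin.rev)
    (u := u ∘ Fin.rev) hav
  rw [hx.unique hLi, map_mul, valued_toKv, hy.unique hy', ← wt_rev s]
  have h1 : val v hv (toK F a) = 1 :=
    le_antisymm (val_toK_le_one v hv a) (not_lt.1 fun h => ha ((val_toK_lt_one_iff v hv a).1 h))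
  rw [map_div₀, h1, map_pow, Valuation.map_neg, map_one, one_pow, div_one, one_mul]
  exact hle

theorem B_nonneg (hv : Irreducible v) {w : ℕ} (hw : w ≤ qv v) : 0 ≤ B v w := by
  obtain ⟨n, hn⟩ := (B_isLeast hv w).1
  rw [← hn]
  have h1 : n * w ≤ qv v ^ n := by
    obtain _ | n := n
    · simp
    -- Here `n + 1 ≤ q_v^n` and `w ≤ q_v` give `(n + 1) w ≤ q_v^(n+1)`.
    · rw [pow_succ]
      exact Nat.mul_le_mul (Nat.lt_pow_self (one_lt_qv hv)) hw
  simp only [sub_nonneg]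
  exact_mod_cast h1

end

end CMSPL

end

theorem corollary3 {F : Type*} [Field F] [Fintype F] (v : F[X]) (_hmonic : v.Monic)
    (hv : Irreducible v) :
    -- the values `Li*_s(u)_v` exist and are well defined
    (∀ (r : ℕ) (s : Fin (r + 1) → ℕ+) (u : Fin (r + 1) → F[X]),
      ∃! x : CMSPL.Kv v hv, CMSPL.IsLi v hv s u x) ∧
    -- part (1)
    (∀ w : ℕ, CMSPL.L v hv w = Submodule.span (RatFunc F) (CMSPL.Sstar v hv w)) ∧
    (∃ R : Subalgebra (RatFunc F) (CMSPL.Kv v hv),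
      Subalgebra.toSubmodule R = ⨆ w : ℕ, CMSPL.L v hv w) ∧
    -- part (2); `ord_v x ≥ b` is written as `|x|_v ≤ exp (-b)`
    (∀ (r : ℕ) (s : Fin (r + 1) → ℕ+) (u : Fin (r + 1) → F[X]) (x : CMSPL.Kv v hv),
      CMSPL.IsLi v hv s u x →
        Valued.v x ≤ WithZero.exp (-CMSPL.B v (CMSPL.wt s)) ∧
        (CMSPL.wt s ≤ CMSPL.qv v →
          x ∈ (CMSPL.place v hv).adicCompletionIntegers (RatFunc F))) := by
  refine ⟨fun r s u => CMSPL.existsUnique_isLi v hv s u _hmonic, CMSPL.L_eq_span_Sstar v hv,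
    ⟨Submodule.toSubalgebra (⨆ w : ℕ, CMSPL.L v hv w) ?_ ?_, ?_⟩,
    fun r s u x hx => ⟨hx.valued_le _hmonic, fun hw => ?_⟩⟩
  · refine Submodule.mem_iSup_of_mem 0 ?_
    rw [CMSPL.L_zero]
    exact Submodule.one_le.1 le_rfl
  · intro x y hx hy
    have h : (⨆ w : ℕ, CMSPL.L v hv w) * (⨆ w : ℕ, CMSPL.L v hv w) ≤ ⨆ w : ℕ, CMSPL.L v hv w := by
      rw [Submodule.iSup_mul]
      refine iSup_le fun w => ?_
      rw [Submodule.mul_iSup]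
      exact iSup_le fun w' => (CMSPL.L_mul_le v hv w w').trans (le_iSup (CMSPL.L v hv) (w + w'))
    exact h (Submodule.mul_mem_mul hx hy)
  · exact Submodule.toSubalgebra_toSubmodule _ _ _
  · rw [IsDedekindDomain.HeightOneSpectrum.mem_adicCompletionIntegers]
    refine (hx.valued_le _hmonic).trans ?_
    rw [← WithZero.exp_zero, WithZero.exp_le_exp, neg_nonpos]
    exact CMSPL.B_nonneg hv hw
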